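/- Let $0\le m\le n$ be integers, and let the rectangular lower-upper scheme \[ E=\{(X,Y)\in \mathrm{Mat}(m,n,\mathbb C)\times \mathrm{Mat}(n,m,\mathbb C):\ XY \text{ is lower triangular and } YX \text{ is upper triangular}\} \] be the affine scheme over $\mathbb C$ cut out by the vanishing of the strictly upper triangular entries of $XY$ and the strictly lower triangular entries of $YX$. Let $B_-$ be the group of invertible lower triangular $m\times m$ complex matrices and $B_+$ the group of invertible upper triangular $n\times n$ complex matrices. For an $m\times n$ partial permutation matrix $\pi$ (a $0$-$1$ matrix with at most one $1$ in each row and each column), let $E^1_\pi$ be the set of complex points $(X,Y)$ of $E$ with $X\in B_-\,\pi\, B_+$, and let $E_\pi=\overline{E^1_\pi}$ be its Zariski closure in $E$. Define $\bar\pi$ as follows: if $i_1<\dots<i_k$ are the zero rows of $\pi$ and $j_1<\dots<j_{n-m+k}$ are the zero columns of $\pi$, then $\bar\pi_{ij}=1$ if $\pi_{ij}=1$ or if $(i,j)=(i_r,j_{n-m+r})$ for some $1\le r\le k$, and $\bar\pi_{ij}=0$ otherwise. Then: 1. $E$ is equidimensional of dimension $m(n+1)$: it is non-empty and each of its irreducible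 components has dimension $m(n+1)$. 2. The irreducible components of $E$ are exactly the sets $E_\pi$, where $\pi$ runs over the $m\times n$ partial permutation matrices of maximal rank $m$. 3. For each $m\times n$ partial permutation matrix $\pi$ of rank less than $m$, the matrix $\bar\pi$ is a partial permutation matrix of rank $m$, and $E^1_\pi\subseteq E_{\bar\pi}$. -/

import Mathlib

open AlgebraicGeometry

noncomputable section

namespace LowerUpper

variable (m n : ℕ)

/-- Entries `(i, j)` of `X` (left summand) and `(j, i)` of `Y` (right summand): the coordinates on
`Mat(m,n) × Mat(n,m)`. -/
abbrev Coord : Type := (Fin m × Fin n) ⊕ (Fin n × Fin m)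

/-- The generic `m × n` matrix `X`. -/
def genericX : Matrix (Fin m) (Fin n) (MvPolynomial (Coord m n) ℂ) :=
  Matrix.of fun i j => MvPolynomial.X (Sum.inl (i, j))

/-- The generic `n × m` matrix `Y`. -/
def genericY : Matrix (Fin n) (Fin m) (MvPolynomial (Coord m n) ℂ) :=
  Matrix.of fun j i => MvPolynomial.X (Sum.inr (j, i))

/-- The ideal of the equations "`XY` is lower triangular and `YX` is upper triangular". -/
def luIdeal : Ideal (MvPolynomial (Coord m n) ℂ) :=
  Ideal.span
    ({f | ∃ i j : Fin m, i < j ∧ f = (genericX m n * genericY m n) i j} ∪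
     {f | ∃ i j : Fin n, j < i ∧ f = (genericY m n * genericX m n) i j})

/-- The coordinate ring of the lower-upper scheme. -/
abbrev CoordRing : Type := MvPolynomial (Coord m n) ℂ ⧸ luIdeal m n

/-- The rectangular lower-upper scheme `E`. -/
def E : Scheme := Spec (CommRingCat.of (CoordRing m n))

variable {m n}

/-- `XY` is lower triangular and `YX` is upper triangular. -/
def IsLowerUpper (X : Matrix (Fin m) (Fin n) ℂ) (Y : Matrix (Fin n) (Fin m) ℂ) : Prop :=
  (∀ i j : Fin m, i < j → (X * Y) i j = 0) ∧ (∀ i j : Fin n, j < i → (Y * X) i j = 0)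

/-- The coordinates of a pair of complex matrices. -/
def coords (X : Matrix (Fin m) (Fin n) ℂ) (Y : Matrix (Fin n) (Fin m) ℂ) : Coord m n → ℂ :=
  Sum.elim (fun p => X p.1 p.2) (fun p => Y p.1 p.2)

theorem eval_eq_zero_of_mem_luIdeal {X : Matrix (Fin m) (Fin n) ℂ} {Y : Matrix (Fin n) (Fin m) ℂ}
    (h : IsLowerUpper X Y) (f : MvPolynomial (Coord m n) ℂ) (hf : f ∈ luIdeal m n) :
    MvPolynomial.eval (coords X Y) f = 0 := by
  have hle : luIdeal m n ≤ RingHom.ker (MvPolynomial.eval (coords X Y)) := by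
    refine Ideal.span_le.2 ?_
    rintro g (⟨i, j, hij, rfl⟩ | ⟨i, j, hij, rfl⟩)
    · simpa [RingHom.mem_ker, Matrix.mul_apply, genericX, genericY, coords] using h.1 i j hij
    · simpa [RingHom.mem_ker, Matrix.mul_apply, genericX, genericY, coords] using h.2 i j hij
  exact hle hf

/-- Evaluation of the functions on `E` at a complex point `(X, Y)` of `E`. -/
def evalHom (X : Matrix (Fin m) (Fin n) ℂ) (Y : Matrix (Fin n) (Fin m) ℂ)
    (h : IsLowerUpper X Y) : CoordRing m n →+* ℂ :=
  Ideal.Quotient.lift (luIdeal m n) (MvPolynomial.eval (coords X Y))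
    (eval_eq_zero_of_mem_luIdeal h)

/-- The (closed) point of the scheme `E` given by a pair `(X, Y)` of complex matrices with `XY` lower
triangular and `YX` upper triangular: the kernel of evaluation at `(X, Y)`. -/
def point (X : Matrix (Fin m) (Fin n) ℂ) (Y : Matrix (Fin n) (Fin m) ℂ)
    (h : IsLowerUpper X Y) : E m n :=
  (⟨RingHom.ker (evalHom X Y h), RingHom.ker_isPrime _⟩ : PrimeSpectrum (CoordRing m n))

/-- A partial permutation matrix: a `0`-`1` matrix with at most one `1` in each row and column. -/
def IsPartialPerm (π : Matrix (Fin m) (Fin n) ℂ) : Prop :=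
  (∀ i j, π i j = 0 ∨ π i j = 1) ∧
  (∀ i j j', π i j = 1 → π i j' = 1 → j = j') ∧
  (∀ i i' j, π i j = 1 → π i' j = 1 → i = i')

/-- The orbit `(B₋ × B₊) · π = {b π c⁻¹}`, where `B₋` is the group of invertible lower triangular
`m × m` matrices and `B₊` the group of invertible upper triangular `n × n` matrices. -/
def borelOrbit (π : Matrix (Fin m) (Fin n) ℂ) : Set (Matrix (Fin m) (Fin n) ℂ) :=
  {X | ∃ (b : GL (Fin m) ℂ) (c : GL (Fin n) ℂ),
    (∀ i j, i < j → b.val i j = 0) ∧ (∀ i j, j < i → c.val i j = 0) ∧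
    X = b.val * π * (c⁻¹).val}

/-- `E¹_π`, the set of the pairs `(X, Y)` in `E` with `X` in the orbit of `π`, as a set of closed
points of the scheme `E`. -/
def E1 (π : Matrix (Fin m) (Fin n) ℂ) : Set (E m n) :=
  {x | ∃ (X : Matrix (Fin m) (Fin n) ℂ) (Y : Matrix (Fin n) (Fin m) ℂ) (h : IsLowerUpper X Y),
    X ∈ borelOrbit π ∧ x = point X Y h}

/-- `E_π`, the closure of `E¹_π` in `E` (Zariski topology). -/
def Ecl (π : Matrix (Fin m) (Fin n) ℂ) : Set (E m n) := closure (E1 π)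

/-- Row `i` of `π` is zero. -/
def IsZeroRow (π : Matrix (Fin m) (Fin n) ℂ) (i : Fin m) : Prop := ∀ j, π i j = 0

/-- Column `j` of `π` is zero. -/
def IsZeroCol (π : Matrix (Fin m) (Fin n) ℂ) (j : Fin n) : Prop := ∀ i, π i j = 0

open Classical in
/-- The completion `π̄`. Let `i_1 < ⋯ < i_k` be the zero rows and `j_1 < ⋯ < j_{n-m+k}` the zero
columns of `π`; then `π̄` is `π` with additional `1`s at the positions `(i_r, j_{n-m+r})`. A zero row
`i` is `i_r` when `r - 1` zero rows precede it, and a zero column `j` is `j_{n-m+r}` when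
`n - m + r - 1` zero columns precede it; the relation between the two counts is written without
subtraction. -/
def completion (π : Matrix (Fin m) (Fin n) ℂ) : Matrix (Fin m) (Fin n) ℂ :=
  Matrix.of fun i j =>
    if π i j = 1 ∨
        (IsZeroRow π i ∧ IsZeroCol π j ∧
          n + (Finset.univ.filter fun i' : Fin m => i' < i ∧ IsZeroRow π i').card =
            m + (Finset.univ.filter fun j' : Fin n => j' < j ∧ IsZeroCol π j').card)
    then 1 else 0

/-- A topological space is equidimensional of dimension `d` if it is nonempty and each of its
irreducible components has Krull dimension `d`. -/
def IsEquidimensional (T : Type*) [TopologicalSpace T] (d : ℕ) : Prop :=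
  Nonempty T ∧ ∀ Z ∈ irreducibleComponents T, topologicalKrullDim Z = d

end LowerUpper

end

/-!
Write `B₋` and `B₊` for the groups of invertible lower and upper triangular matrices. A pair `(X, Y)`
lies in the scheme exactly when `Y` is orthogonal, for the trace form, to the tangent space at `X` of
its orbit under unipotent row and column operations, so over each point of an orbit `B₋ π B₊` the
fibre is a linear space. A stratum is the set of all pairs with `X` in such an orbit; by the Bruhat
decomposition (`exists_bruhat`) the strata cover all complex points.

*Dimension.* Let `π` have rank `m`, with ones at `(i, σ i)`. Row reduction writes `X ∈ B₋ π B₊`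
uniquely as `b Z`, with `b` lower triangular and `Z` reduced with pivots at the `(i, σ i)`; then
`Z = π u` for a unitriangular `u` depending polynomially on `Z`, and `Y` is conjugate under `b` and `u`
to an element of the fibre over `π`. For each row, the numbers of parameters of `b`, `Z` and the fibre
add up to `n + 1`. The resulting parametrisation (`paramX`, `paramY`) of the stratum is polynomial and
birational: its kernel on functions is the vanishing ideal of the stratum (`paramHom_eq_zero_iff`),
and all parameters are algebraic over its image (`param_mem_of_division_closed`). So the closure of
the stratum is irreducible, of dimension `m (n + 1)`, because the dimension of a finitely generated
domain is its transcendence degree (`ringKrullDim_eq_of_trdeg_eq`, from Noether normalisation and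
going up).

*Degeneration.* Let `π` have any rank, and let `ρ` be its completion. After conjugation a point of the
stratum of `π` is `(π, Y)`. The line `Y + s ρᵀ` stays in the fibre over `π`, and for almost all `s` it
lies in `B₊ ρᵀ B₋`. Indeed double cosets are characterised by ranks of corner submatrices
(`IsPP.exists_eq_mul_mul_of_upper`); these are bounded below by genericity
(`IsPP.finite_rank_add_smul_lt`) and above by counting rows and columns (`IsLowerUpper.rank_cut_le`).
Once `Y = ρᵀ`, the line `X + t ρ` stays in the fibre and lies in `ρ B₊` for almost all `t`. A
polynomial vanishing on the stratum of `ρ` thus vanishes at almost all points of these lines, hence on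
the stratum of `π` (`IsPP.eval_eq_zero_of_completion`).

*Components.* The strata of maximal rank are therefore dense; their closures are finitely many
irreducible closed sets of the same finite dimension, so none contains another one properly, and they
are the irreducible components (`irreducibleComponents_eq`).
-/

namespace LowerUpper

open Matrix

/-! ### Krull dimension of subalgebras of polynomial rings -/

/-- Integral extensions preserve the dimension: contraction of primes is strictly monotone by
incomparability, and going up lifts chains of primes. -/
theorem ringKrullDim_eq_of_isIntegral (R S : Type*) [CommRing R] [CommRing S] [Algebra R S]
    [Algebra.IsIntegral R S] (hinj : Function.Injective (algebraMap R S)) :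
    ringKrullDim S = ringKrullDim R := by
  have : FaithfulSMul R S := (faithfulSMul_iff_algebraMap_injective R S).2 hinj
  refine le_antisymm ?_ ?_
  · refine Order.krullDim_le_of_strictMono (PrimeSpectrum.comap (algebraMap R S)) ?_
    intro P Q hPQ
    exact Ideal.IsIntegral.comap_lt_comap (I := P.asIdeal) (J := Q.asIdeal) hPQ
  · -- Going up shows that the coheight of a prime of `S` is at least that of its contraction.
    have key : ∀ (k : ℕ) (P : PrimeSpectrum S),
        (k : ℕ∞) ≤ Order.coheight (PrimeSpectrum.comap (algebraMap R S) P) →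
          (k : ℕ∞) ≤ Order.coheight P := by
      intro k
      induction k with
      | zero => intro P _; simp
      | succ k ih =>
        intro P hP
        by_contra hcon
        have hle : Order.coheight P ≤ k := by
          have h2 : Order.coheight P < ((k : ℕ∞) + 1) := by simpa using hcon
          exact Order.le_of_lt_add_one h2
        rw [Order.coheight_le_coe_iff] at hle
        have h3 : Order.coheight (PrimeSpectrum.comap (algebraMap R S) P) ≤ k := by
          rw [Order.coheight_le_coe_iff]
          intro q hq
          obtain ⟨Q, hQ1, hQ2, hQ3⟩ := Ideal.exists_ideal_over_prime_of_isIntegral_of_isPrime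
            q.asIdeal P.asIdeal (le_of_lt hq)
          have hPQ : P < (⟨Q, hQ2⟩ : PrimeSpectrum S) := by
            refine lt_of_le_of_ne hQ1 ?_
            rintro rfl
            exact absurd (PrimeSpectrum.ext hQ3) hq.ne
          have h4 := hle _ hPQ
          by_contra h5
          have h6 := ih ⟨Q, hQ2⟩ (by
            have : PrimeSpectrum.comap (algebraMap R S) ⟨Q, hQ2⟩ = q := PrimeSpectrum.ext hQ3
            rw [this]; exact not_lt.1 h5)
          exact absurd h4 (not_lt.2 h6)
        have := hP.trans h3
        norm_cast at this
        omega
    refine iSup_le fun l => ?_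
    obtain ⟨Q, -, hQ1, hQ2⟩ := Ideal.exists_ideal_over_prime_of_isIntegral (S := S)
      l.head.asIdeal ⊥ (by
        rw [← RingHom.ker_eq_comap_bot, (RingHom.injective_iff_ker_eq_bot _).1 hinj]
        exact bot_le)
    have h1 : PrimeSpectrum.comap (algebraMap R S) ⟨Q, hQ1⟩ = l.head := PrimeSpectrum.ext hQ2
    have h2 := key l.length ⟨Q, hQ1⟩ (by rw [h1]; exact Order.length_le_coheight_head)
    refine le_trans ?_ (Order.coheight_le_krullDim (⟨Q, hQ1⟩ : PrimeSpectrum S))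
    exact_mod_cast h2

open MvPolynomial in
/-- The dimension of a finitely generated domain over a field is its transcendence degree. -/
theorem ringKrullDim_eq_of_trdeg_eq (k A : Type) [Field k] [CommRing A] [IsDomain A] [Algebra k A]
    [Algebra.FiniteType k A] (N : ℕ) (h : Algebra.trdeg k A = N) : ringKrullDim A = N := by
  obtain ⟨s, g, hg, hint⟩ := exists_integral_inj_algHom_of_fg k A
  let : Algebra (MvPolynomial (Fin s) k) A := g.toRingHom.toAlgebra
  have : IsScalarTower k (MvPolynomial (Fin s) k) A :=
    IsScalarTower.of_algebraMap_eq' g.comp_algebraMap.symm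
  have hinj : Function.Injective (algebraMap (MvPolynomial (Fin s) k) A) := hg
  have : FaithfulSMul (MvPolynomial (Fin s) k) A := (faithfulSMul_iff_algebraMap_injective _ _).2 hinj
  have : Algebra.IsIntegral (MvPolynomial (Fin s) k) A := ⟨hint⟩
  have h1 := trdeg_add_eq k (MvPolynomial (Fin s) k) (A := A)
  have h2 : Algebra.trdeg (MvPolynomial (Fin s) k) A = 0 := trdeg_eq_zero
  rw [h2, MvPolynomial.trdeg_of_isDomain, h] at h1
  have hs : s = N := by simpa using h1
  rw [ringKrullDim_eq_of_isIntegral (MvPolynomial (Fin s) k) A hinj,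
    MvPolynomial.ringKrullDim_of_isNoetherianRing, ringKrullDim_eq_zero_of_field]
  simp [hs]

open MvPolynomial in
/-- If every variable is algebraic over the image of the ring map `θ` corresponding to a map from an
affine space, then the closure of the image of this map has the dimension of its source. -/
theorem ringKrullDim_quotient_ker {A ι k : Type} [Fintype ι] [Field k] [CommRing A] [Algebra k A]
    [Algebra.FiniteType k A] (θ : A →ₐ[k] MvPolynomial ι k)
    (h : ∀ i, IsAlgebraic θ.range (X i : MvPolynomial ι k)) :
    ringKrullDim (A ⧸ RingHom.ker θ) = Fintype.card ι := by
  have e : (A ⧸ RingHom.ker θ) ≃ₐ[k] θ.range := Ideal.quotientKerEquivRange θ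
  rw [ringKrullDim_eq_of_ringEquiv e.toRingEquiv]
  have : Algebra.FiniteType k θ.range :=
    Algebra.FiniteType.of_surjective θ.rangeRestrict θ.rangeRestrict_surjective
  refine ringKrullDim_eq_of_trdeg_eq k θ.range _ ?_
  have halg : Algebra.IsAlgebraic θ.range (MvPolynomial ι k) := by
    refine ⟨fun p => ?_⟩
    induction p using MvPolynomial.induction_on with
    | C a => exact isAlgebraic_algebraMap (algebraMap k θ.range a)
    | add p q hp hq => exact hp.add hq
    | mul_X p i hp => exact hp.mul (h i)
  have h1 := trdeg_add_eq k θ.range (A := MvPolynomial ι k)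
  rw [trdeg_eq_zero (R := θ.range), MvPolynomial.trdeg_of_isDomain] at h1
  simpa using h1

/-- Nested primes with quotients of the same finite dimension are equal. -/
theorem eq_of_le_of_ringKrullDim_quotient_eq {R : Type*} [CommRing R] {P Q : Ideal R} [P.IsPrime]
    [Q.IsPrime] (hPQ : P ≤ Q) (N : ℕ) (hP : ringKrullDim (R ⧸ P) = N)
    (hQ : ringKrullDim (R ⧸ Q) = N) : P = Q := by
  refine le_antisymm hPQ fun r hr => ?_
  by_contra hrP
  have h1 : Ideal.Quotient.mk P r ≠ 0 := by rwa [Ne, Ideal.Quotient.eq_zero_iff_mem]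
  have h2 := ringKrullDim_succ_le_of_surjective (Ideal.Quotient.factor hPQ)
    (Ideal.Quotient.factor_surjective hPQ) (mem_nonZeroDivisors_of_ne_zero h1)
    (by simpa [Ideal.Quotient.eq_zero_iff_mem] using hr)
  rw [hP, hQ] at h2
  norm_cast at h2
  omega

/-! ### Partial permutation matrices -/

section PartialPermutation

variable {α β : Type*}

/-- Partial permutation matrices with arbitrary index types and coefficients. -/
def IsPP {R : Type*} [Zero R] [One R] (π : Matrix α β R) : Prop :=
  (∀ i j, π i j = 0 ∨ π i j = 1) ∧
  (∀ i j j', π i j = 1 → π i j' = 1 → j = j') ∧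
  (∀ i i' j, π i j = 1 → π i' j = 1 → i = i')

theorem IsPartialPerm.isPP {m n : ℕ} {π : Matrix (Fin m) (Fin n) ℂ} (h : IsPartialPerm π) :
    IsPP π := h

theorem IsPP.transpose {R : Type*} [Zero R] [One R] {π : Matrix α β R} (h : IsPP π) : IsPP πᵀ :=
  ⟨fun i j => h.1 j i, fun i j j' h1 h2 => h.2.2 j j' i h1 h2,
    fun i i' j h1 h2 => h.2.1 j i i' h1 h2⟩

variable {R : Type*} [CommRing R]

theorem IsPP.eq_zero_of_left {π : Matrix α β R} (h : IsPP π) {i : α} {j j' : β} (h1 : π i j = 1)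
    (hj : j' ≠ j) : π i j' = 0 :=
  (h.1 i j').resolve_right fun h2 => hj (h.2.1 i j' j h2 h1)

theorem IsPP.eq_zero_of_right {π : Matrix α β R} (h : IsPP π) {i i' : α} {j : β} (h1 : π i j = 1)
    (hi : i' ≠ i) : π i' j = 0 :=
  (h.1 i' j).resolve_right fun h2 => hi (h.2.2 i' i j h2 h1)

theorem IsPP.mul_apply {γ : Type*} [Fintype β] {π : Matrix α β R} (h : IsPP π) {i : α} {j : β}
    (h1 : π i j = 1) (A : Matrix β γ R) (l : γ) : (π * A) i l = A j l := by
  rw [Matrix.mul_apply, Finset.sum_eq_single j]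
  · rw [h1, one_mul]
  · intro j' _ hj
    rw [h.eq_zero_of_left h1 hj, zero_mul]
  · simp

theorem mul_apply_of_row_eq_zero {γ : Type*} [Fintype β] {π : Matrix α β R} {i : α}
    (h1 : ∀ j, π i j = 0) (A : Matrix β γ R) (l : γ) : (π * A) i l = 0 := by
  simp [Matrix.mul_apply, h1]

theorem IsPP.apply_mul {γ : Type*} [Fintype α] {π : Matrix α β R} (h : IsPP π) {i : α} {j : β}
    (h1 : π i j = 1) (A : Matrix γ α R) (l : γ) : (A * π) l j = A l i := by
  have := h.transpose.mul_apply (i := j) (j := i) h1 Aᵀ l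
  rwa [← Matrix.transpose_mul] at this

open Classical in
theorem IsPP.mul_transpose [Fintype β] {π : Matrix α β R} (h : IsPP π) :
    π * πᵀ = Matrix.diagonal fun i => if ∃ j, π i j = 1 then (1 : R) else 0 := by
  ext i i'
  by_cases hi : ∃ j, π i j = 1
  · obtain ⟨j, hj⟩ := hi
    rw [h.mul_apply hj, Matrix.transpose_apply]
    by_cases hii : i = i'
    · subst hii
      rw [hj, Matrix.diagonal_apply_eq, if_pos ⟨j, hj⟩]
    · rw [Matrix.diagonal_apply_ne _ hii, h.eq_zero_of_right hj (Ne.symm hii)]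
  · rw [mul_apply_of_row_eq_zero (fun j => (h.1 i j).resolve_right fun h1 => hi ⟨j, h1⟩),
      Matrix.diagonal_apply, if_neg hi, ite_self]

open Classical in
theorem IsPP.mul_transpose_mul [Fintype α] [Fintype β] {π : Matrix α β R} (h : IsPP π) :
    π * πᵀ * π = π := by
  ext i j
  rw [h.mul_transpose, Matrix.diagonal_mul]
  split_ifs with hi
  · rw [one_mul]
  · rw [zero_mul]
    exact ((h.1 i j).resolve_right fun h1 => hi ⟨j, h1⟩).symm

open Classical in
theorem IsPP.rank_eq [Fintype α] [Fintype β] {π : Matrix α β ℂ} (h : IsPP π) :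
    π.rank = (Finset.univ.filter fun i => ∃ j, π i j = 1).card := by
  have h1 : (π * πᵀ).rank = (Finset.univ.filter fun i => ∃ j, π i j = 1).card := by
    rw [h.mul_transpose, Matrix.rank_diagonal, Fintype.card_subtype]
    congr 1
    ext i
    simp
  refine le_antisymm ?_ (h1 ▸ Matrix.rank_mul_le_left _ _)
  conv_lhs => rw [← h.mul_transpose_mul]
  rw [← h1]
  exact Matrix.rank_mul_le_left _ _

open Classical in
theorem IsPP.rank_eq' [Fintype α] [Fintype β] {π : Matrix α β ℂ} (h : IsPP π) :
    π.rank = (Finset.univ.filter fun j => ∃ i, π i j = 1).card := by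
  rw [← Matrix.rank_transpose, h.transpose.rank_eq]
  rfl

theorem IsPP.card_zeroRow_add_rank [Fintype α] [Fintype β] {π : Matrix α β ℂ} (h : IsPP π)
    (P : α → Prop) [DecidablePred P] (hP : ∀ i, P i ↔ ∀ j, π i j = 0) :
    (Finset.univ.filter P).card + π.rank = Fintype.card α := by
  classical
  have h1 : (Finset.univ.filter fun i => ∃ j, π i j = 1) = Finset.univ.filter fun i => ¬ P i := by
    refine Finset.filter_congr fun i _ => ?_
    rw [hP, not_forall]
    refine exists_congr fun j => ⟨fun h1 => h1 ▸ one_ne_zero, fun h1 => (h.1 i j).resolve_left h1⟩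
  rw [h.rank_eq, h1, Finset.card_filter_add_card_filter_not, Finset.card_univ]

open Classical in
/-- The matrix obtained from `X` by replacing by zero the entries outside of `s × t`. It has the
rank of the corresponding submatrix. -/
noncomputable def cut {R : Type*} [Zero R] (s : Set α) (t : Set β) (X : Matrix α β R) : Matrix α β R :=
  Matrix.of fun i j => if i ∈ s ∧ j ∈ t then X i j else 0

theorem IsPP.isPP_cut [Nontrivial R] {π : Matrix α β R} (h : IsPP π) (s : Set α) (t : Set β) :
    IsPP (cut s t π) := by
  have key : ∀ i j, cut s t π i j = 1 → π i j = 1 := by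
    intro i j
    simp only [cut, Matrix.of_apply]
    split_ifs
    · exact id
    · simp
  refine ⟨fun i j => ?_, fun i j j' h1 h2 => h.2.1 i j j' (key _ _ h1) (key _ _ h2),
    fun i i' j h1 h2 => h.2.2 i i' j (key _ _ h1) (key _ _ h2)⟩
  simp only [cut, Matrix.of_apply]
  split_ifs
  · exact h.1 i j
  · exact Or.inl rfl

theorem cut_apply_eq_one_iff [Nontrivial R] {π : Matrix α β R} {s : Set α} {t : Set β} {i : α} {j : β} :
    cut s t π i j = 1 ↔ i ∈ s ∧ j ∈ t ∧ π i j = 1 := by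
  simp only [cut, Matrix.of_apply]
  split_ifs with h
  · simp [h]
  · simp only [zero_ne_one, false_iff]
    exact fun h1 => h ⟨h1.1, h1.2.1⟩

open Classical in
theorem cut_eq_mul [DecidableEq α] [DecidableEq β] [Fintype α] [Fintype β] (s : Set α) (t : Set β) (X : Matrix α β R) :
    cut s t X = Matrix.diagonal (fun i => if i ∈ s then (1 : R) else 0) * X *
      Matrix.diagonal (fun j => if j ∈ t then (1 : R) else 0) := by
  ext i j
  rw [Matrix.mul_diagonal, Matrix.diagonal_mul]
  by_cases hi : i ∈ s <;> by_cases hj : j ∈ t <;> simp [cut, hi, hj]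

/-- Adding a large multiple of a partial permutation matrix `B` does not make the rank smaller than
that of `B`. With `M = D A Bᵀ` and the projector `D = B Bᵀ`, one has
`D (A + s B) Bᵀ = D (M + s)`, and `M + s` is invertible unless `-s` is an eigenvalue of `M`. -/
theorem IsPP.finite_rank_add_smul_lt [Fintype α] [Fintype β] {B : Matrix α β ℂ} (hB : IsPP B)
    (A : Matrix α β ℂ) : {s : ℂ | (A + s • B).rank < B.rank}.Finite := by
  classical
  set D := B * Bᵀ with hD
  have hDD : D * D = D := by rw [hD, ← Matrix.mul_assoc, hB.mul_transpose_mul]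
  have hDB : D * B = B := hB.mul_transpose_mul
  set M := D * A * Bᵀ with hM
  have hfin : {s : ℂ | (-M).charpoly.IsRoot s}.Finite :=
    Polynomial.finite_setOfPred_isRoot (Matrix.charpoly_monic _).ne_zero
  refine hfin.subset fun s hs => ?_
  by_contra hroot
  have hdet : (M + s • 1).det ≠ 0 := by
    intro h0
    apply hroot
    change (-M).charpoly.IsRoot s
    rw [Polynomial.IsRoot, Matrix.eval_charpoly, ← h0]
    congr 1
    ext i j
    simp [Matrix.scalar_apply, Matrix.diagonal_apply, Matrix.one_apply, add_comm]
  have h1 : D * (A + s • B) * Bᵀ = D * (M + s • 1) := by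
    rw [Matrix.mul_add, Matrix.add_mul, Matrix.mul_add, hM]
    congr 1
    · rw [← Matrix.mul_assoc, ← Matrix.mul_assoc, hDD]
    · rw [Matrix.mul_smul, Matrix.smul_mul, hDB, Matrix.mul_smul, Matrix.mul_one]
  have h2 : D.rank ≤ (A + s • B).rank := by
    rw [← Matrix.rank_mul_eq_left_of_det_ne_zero (M + s • 1) D hdet, ← h1]
    exact (Matrix.rank_mul_le_left _ _).trans (Matrix.rank_mul_le_right _ _)
  have h3 : B.rank ≤ D.rank := by
    conv_lhs => rw [← hDB]
    exact Matrix.rank_mul_le_left _ _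
  exact absurd hs (not_lt.2 (h3.trans h2))

end PartialPermutation

open Classical in
/-- The square matrix having the rows of `Z` at the positions prescribed by `π` and the rows of the
identity matrix elsewhere. -/
noncomputable def rowExtend {α β R : Type*} [Fintype α] [DecidableEq β] [CommRing R] (π Z : Matrix α β R) : Matrix β β R :=
  Matrix.of fun j l => if ∃ i, π i j = 1 then (πᵀ * Z) j l else if j = l then 1 else 0

section RowExtend

variable {α β R : Type*} [Fintype α] [CommRing R] {π Z : Matrix α β R}

theorem IsPP.rowExtend_apply [DecidableEq β] (h : IsPP π) {i : α} {j : β} (hij : π i j = 1) (l : β) :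
    rowExtend π Z j l = Z i l := by
  rw [rowExtend, Matrix.of_apply, if_pos ⟨i, hij⟩]
  exact h.transpose.mul_apply hij Z l

theorem rowExtend_apply_of_not_exists [DecidableEq β] {j : β} (hj : ¬ ∃ i, π i j = 1) (l : β) :
    rowExtend π Z j l = if j = l then 1 else 0 := by
  rw [rowExtend, Matrix.of_apply, if_neg hj]

theorem IsPP.mul_rowExtend [DecidableEq β] [Fintype β] (h : IsPP π) (hz : ∀ i, (∀ j, π i j = 0) → ∀ l, Z i l = 0) :
    π * rowExtend π Z = Z := by
  ext i l
  by_cases hi : ∃ j, π i j = 1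
  · obtain ⟨j, hj⟩ := hi
    rw [h.mul_apply hj, h.rowExtend_apply hj]
  · have : ∀ j, π i j = 0 := fun j => (h.1 i j).resolve_right fun h1 => hi ⟨j, h1⟩
    rw [mul_apply_of_row_eq_zero this, hz i this]

theorem IsPP.rowExtend_isUpperTriangular [LinearOrder β] (h : IsPP π)
    (hl : ∀ i j l, π i j = 1 → l < j → Z i l = 0) : (rowExtend π Z).IsUpperTriangular := by
  intro j l hlj
  by_cases hj : ∃ i, π i j = 1
  · obtain ⟨i, hi⟩ := hj
    rw [h.rowExtend_apply hi, hl i j l hi hlj]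
  · rw [rowExtend_apply_of_not_exists hj, if_neg (show l < j from hlj).ne']

theorem IsPP.det_rowExtend [LinearOrder β] [Fintype β] (h : IsPP π) (hl : ∀ i j l, π i j = 1 → l < j → Z i l = 0)
    (hp : ∀ i j, π i j = 1 → Z i j = 1) : (rowExtend π Z).det = 1 := by
  rw [Matrix.det_of_isUpperTriangular (h.rowExtend_isUpperTriangular hl)]
  refine Finset.prod_eq_one fun j _ => ?_
  by_cases hj : ∃ i, π i j = 1
  · obtain ⟨i, hi⟩ := hj
    rw [h.rowExtend_apply hi, hp i j hi]
  · rw [rowExtend_apply_of_not_exists hj, if_pos rfl]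

end RowExtend

/-! ### Triangular groups -/

section Triangular

variable {α : Type*} [LinearOrder α]

/-- Invertible lower triangular matrices; invertibility is stated through the diagonal. -/
def lowerBorel (α : Type*) [LinearOrder α] : Set (Matrix α α ℂ) :=
  {b | (∀ i j, i < j → b i j = 0) ∧ ∀ i, b i i ≠ 0}

/-- Invertible upper triangular matrices; invertibility is stated through the diagonal. -/
def upperBorel (α : Type*) [LinearOrder α] : Set (Matrix α α ℂ) :=
  {b | (∀ i j, j < i → b i j = 0) ∧ ∀ i, b i i ≠ 0}

theorem transpose_mem_lowerBorel {b : Matrix α α ℂ} : bᵀ ∈ lowerBorel α ↔ b ∈ upperBorel α :=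
  ⟨fun h => ⟨fun i j hij => h.1 j i hij, h.2⟩, fun h => ⟨fun i j hij => h.1 j i hij, h.2⟩⟩

variable [Fintype α]

theorem det_ne_zero_of_mem_lowerBorel {b : Matrix α α ℂ} (hb : b ∈ lowerBorel α) : b.det ≠ 0 := by
  rw [Matrix.det_of_isLowerTriangular b fun i j hij => hb.1 i j hij]
  exact Finset.prod_ne_zero_iff.2 fun i _ => hb.2 i

theorem mem_lowerBorel_of_det_ne_zero {b : Matrix α α ℂ} (h : ∀ i j, i < j → b i j = 0)
    (hdet : b.det ≠ 0) : b ∈ lowerBorel α := by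
  rw [Matrix.det_of_isLowerTriangular b fun i j hij => h i j hij] at hdet
  exact ⟨h, fun i => Finset.prod_ne_zero_iff.1 hdet i (Finset.mem_univ i)⟩

theorem mem_upperBorel_of_det_ne_zero {b : Matrix α α ℂ} (h : ∀ i j, j < i → b i j = 0)
    (hdet : b.det ≠ 0) : b ∈ upperBorel α :=
  transpose_mem_lowerBorel.1 (mem_lowerBorel_of_det_ne_zero (fun i j hij => h j i hij)
    (by rwa [Matrix.det_transpose]))

theorem mul_mem_lowerBorel {b c : Matrix α α ℂ} (hb : b ∈ lowerBorel α) (hc : c ∈ lowerBorel α) :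
    b * c ∈ lowerBorel α := by
  refine mem_lowerBorel_of_det_ne_zero ?_ ?_
  · have h1 : b.IsLowerTriangular := fun i j hij => hb.1 i j hij
    have h2 : c.IsLowerTriangular := fun i j hij => hc.1 i j hij
    exact fun i j hij => (h1.mul h2) hij
  · rw [Matrix.det_mul]
    exact mul_ne_zero (det_ne_zero_of_mem_lowerBorel hb) (det_ne_zero_of_mem_lowerBorel hc)

theorem mul_mem_upperBorel {b c : Matrix α α ℂ} (hb : b ∈ upperBorel α) (hc : c ∈ upperBorel α) :
    b * c ∈ upperBorel α := by
  rw [← transpose_mem_lowerBorel, Matrix.transpose_mul]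
  exact mul_mem_lowerBorel (transpose_mem_lowerBorel.2 hc) (transpose_mem_lowerBorel.2 hb)

theorem exists_inv_of_mem_lowerBorel {b : Matrix α α ℂ} (hb : b ∈ lowerBorel α) :
    ∃ b' ∈ lowerBorel α, b * b' = 1 ∧ b' * b = 1 := by
  have hu : IsUnit b.det := (det_ne_zero_of_mem_lowerBorel hb).isUnit
  have := Matrix.invertibleOfIsUnitDet b hu
  have h1 : b.IsLowerTriangular := fun i j hij => hb.1 i j hij
  have h2 := Matrix.blockTriangular_inv_of_blockTriangular h1
  refine ⟨b⁻¹, mem_lowerBorel_of_det_ne_zero (fun i j hij => h2 hij) ?_,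
    Matrix.mul_nonsing_inv _ hu, Matrix.nonsing_inv_mul _ hu⟩
  exact (Matrix.isUnit_nonsing_inv_det _ hu).ne_zero

theorem exists_inv_of_mem_upperBorel {b : Matrix α α ℂ} (hb : b ∈ upperBorel α) :
    ∃ b' ∈ upperBorel α, b * b' = 1 ∧ b' * b = 1 := by
  obtain ⟨c, hc, h1, h2⟩ := exists_inv_of_mem_lowerBorel (transpose_mem_lowerBorel.2 hb)
  refine ⟨cᵀ, transpose_mem_lowerBorel.1 (by rwa [Matrix.transpose_transpose]), ?_, ?_⟩
  · simpa using congrArg Matrix.transpose h2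
  · simpa using congrArg Matrix.transpose h1

end Triangular

/-! ### Bruhat decomposition of rectangular matrices -/

section Bruhat

variable {α β : Type*} [LinearOrder α] [Fintype α] [LinearOrder β] [Fintype β]

/-- Every vector is congruent modulo `W` to one vanishing at all leading positions of elements of
`W`: the leading positions are cleared in increasing order, which preserves the earlier zeros. -/
theorem exists_mem_sub_apply_eq_zero (W : Submodule ℂ (β → ℂ)) (x : β → ℂ) :
    ∃ w ∈ W, ∀ j, (∃ v ∈ W, v j ≠ 0 ∧ ∀ l < j, v l = 0) → (x - w) j = 0 := by
  suffices h : ∀ s : Finset β, ∃ w ∈ W, ∀ j ∈ s, (∃ v ∈ W, v j ≠ 0 ∧ ∀ l < j, v l = 0) →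
      (x - w) j = 0 by
    obtain ⟨w, hw, h1⟩ := h Finset.univ
    exact ⟨w, hw, fun j => h1 j (Finset.mem_univ j)⟩
  intro s
  induction s using Finset.induction_on_max with
  | empty => exact ⟨0, W.zero_mem, by simp⟩
  | insert a s ha ih =>
    obtain ⟨w, hw, h1⟩ := ih
    by_cases hp : ∃ v ∈ W, v a ≠ 0 ∧ ∀ l < a, v l = 0
    · obtain ⟨v, hv, hva, hvl⟩ := hp
      refine ⟨w + ((x - w) a / v a) • v, W.add_mem hw (W.smul_mem _ hv), fun j hj hj' => ?_⟩
      rcases Finset.mem_insert.1 hj with rfl | hj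
      · simp only [Pi.sub_apply, Pi.add_apply, Pi.smul_apply, smul_eq_mul]
        field_simp
        ring
      · have := h1 j hj hj'
        simp only [Pi.sub_apply, Pi.add_apply, Pi.smul_apply, smul_eq_mul, hvl j (ha j hj)] at this ⊢
        linear_combination this
    · refine ⟨w, hw, fun j hj hj' => ?_⟩
      rcases Finset.mem_insert.1 hj with rfl | hj
      · exact absurd hj' hp
      · exact h1 j hj hj'

/-- Each row of `X` is corrected by a combination of the earlier rows so that it vanishes at all
leading positions of the span of these. -/
theorem exists_lowerBorel_mul_rowReduced (X : Matrix α β ℂ) :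
    ∃ b ∈ lowerBorel α, ∀ i k j, k < i → (b * X) k j ≠ 0 → (∀ l < j, (b * X) k l = 0) →
      (b * X) i j = 0 := by
  classical
  -- `S i` holds the coefficient vectors of combinations of the rows before the `i`-th one.
  let S : α → Submodule ℂ (α → ℂ) := fun i =>
    { carrier := {c | ∀ k, i ≤ k → c k = 0}
      add_mem' := fun {a b} ha hb k hk => by simp [ha k hk, hb k hk]
      zero_mem' := fun k _ => rfl
      smul_mem' := fun r a ha k hk => by simp [ha k hk] }
  have hex : ∀ i, ∃ c ∈ S i, ∀ j, (∃ v ∈ S i, (v ᵥ* X) j ≠ 0 ∧ ∀ l < j, (v ᵥ* X) l = 0) →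
      (X i - c ᵥ* X) j = 0 := by
    intro i
    obtain ⟨w, hw, h1⟩ := exists_mem_sub_apply_eq_zero ((S i).map X.vecMulLinear) (X i)
    obtain ⟨c, hc, rfl⟩ := hw
    refine ⟨c, hc, fun j hj => ?_⟩
    obtain ⟨v, hv, h2, h3⟩ := hj
    exact h1 j ⟨_, ⟨v, hv, rfl⟩, h2, h3⟩
  choose c hc h1 using hex
  let b : Matrix α α ℂ := Matrix.of fun i => Pi.single i 1 - c i
  have hbX : ∀ i, (b * X) i = X i - c i ᵥ* X := fun i => by
    rw [Matrix.mul_apply_eq_vecMul]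
    change (Pi.single i 1 - c i) ᵥ* X = _
    rw [Matrix.sub_vecMul, Matrix.single_one_vecMul]
    rfl
  refine ⟨b, ⟨fun i j hij => ?_, fun i => ?_⟩, fun i k j hki hk hl => ?_⟩
  · simp [b, hc i j hij.le, hij.ne']
  · simp [b, hc i i le_rfl]
  · rw [hbX i]
    refine h1 i j ⟨b k, fun l hl => ?_, ?_, ?_⟩
    · simp [b, hc k l (hki.le.trans hl), (hki.trans_le hl).ne']
    · rwa [← Matrix.mul_apply_eq_vecMul]
    · rwa [← Matrix.mul_apply_eq_vecMul]

/-- The rows of `Z` are reduced with pivots at the ones of `π`: the pivot is the first nonzero entry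
of its row and equal to `1`, the entries below it vanish, and rows without pivot vanish. -/
structure IsReduced {R : Type*} [Zero R] [One R] (π Z : Matrix α β R) : Prop where
  zero_row : ∀ i, (∀ j, π i j = 0) → ∀ l, Z i l = 0
  pivot : ∀ i j, π i j = 1 → Z i j = 1
  left : ∀ i j l, π i j = 1 → l < j → Z i l = 0
  below : ∀ i k j, π i j = 1 → i < k → Z k j = 0

/-- Normal form of a rectangular matrix under invertible lower triangular row operations. -/
theorem exists_eq_lowerBorel_mul_isReduced (X : Matrix α β ℂ) :
    ∃ b ∈ lowerBorel α, ∃ π Z : Matrix α β ℂ, IsPP π ∧ IsReduced π Z ∧ X = b * Z := by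
  classical
  obtain ⟨b', hb', hred⟩ := exists_lowerBorel_mul_rowReduced X
  obtain ⟨b₁, hb₁, -, hb₁b'⟩ := exists_inv_of_mem_lowerBorel hb'
  set V := b' * X with hV
  -- `lead i j` means that `j` is the leading position of row `i` of `V`; `d` collects the leading
  -- entries, with `1` for the zero rows.
  let lead : α → β → Prop := fun i j => V i j ≠ 0 ∧ ∀ l < j, V i l = 0
  have huniq : ∀ i j j', lead i j → lead i j' → j = j' := by
    intro i j j' h1 h2
    rcases lt_trichotomy j j' with h | h | h
    · exact absurd (h2.2 j h) h1.1
    · exact h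
    · exact absurd (h1.2 j' h) h2.1
  let d : α → ℂ := fun i => if h : ∃ j, lead i j then V i h.choose else 1
  have hd : ∀ i j, lead i j → d i = V i j := by
    intro i j hij
    have hex : ∃ j, lead i j := ⟨j, hij⟩
    simp only [d, dif_pos hex]
    rw [huniq i _ j hex.choose_spec hij]
  have hd0 : ∀ i, d i ≠ 0 := by
    intro i
    by_cases hex : ∃ j, lead i j
    · obtain ⟨j, hj⟩ := hex
      rw [hd i j hj]; exact hj.1
    · simp [d, dif_neg hex]
  have hlead : ∀ i j, V i j ≠ 0 → ∃ j', lead i j' := by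
    intro i j hij
    obtain ⟨j', hj', hmin⟩ := WellFounded.has_min (wellFounded_lt (α := β)) {j | V i j ≠ 0} ⟨j, hij⟩
    exact ⟨j', hj', fun l hl => by_contra fun h => hmin l h hl⟩
  let π : Matrix α β ℂ := Matrix.of fun i j => if lead i j then 1 else 0
  have hπ : ∀ i j, π i j = 1 → lead i j := by
    intro i j h
    by_contra hcon
    simp [π, hcon] at h
  refine ⟨b₁ * Matrix.diagonal d, mul_mem_lowerBorel hb₁ ⟨fun i j hij => ?_, fun i => ?_⟩, π,
    Matrix.diagonal (fun i => (d i)⁻¹) * V, ⟨fun i j => ?_, fun i j j' h1 h2 => ?_,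
    fun i i' j h1 h2 => ?_⟩, ⟨fun i hi l => ?_, fun i j hij => ?_, fun i j l hij hl => ?_,
    fun i k j hij hk => ?_⟩, ?_⟩
  · exact Matrix.diagonal_apply_ne _ hij.ne
  · rw [Matrix.diagonal_apply_eq]; exact hd0 i
  · by_cases h : lead i j <;> simp [π, h]
  · exact huniq i j j' (hπ _ _ h1) (hπ _ _ h2)
  · rcases lt_trichotomy i i' with h | h | h
    · exact absurd (hred i' i j h (hπ _ _ h1).1 (hπ _ _ h1).2) (hπ _ _ h2).1
    · exact h
    · exact absurd (hred i i' j h (hπ _ _ h2).1 (hπ _ _ h2).2) (hπ _ _ h1).1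
  · rw [Matrix.diagonal_mul]
    by_contra hcon
    obtain ⟨j, hj⟩ := hlead i l (right_ne_zero_of_mul hcon)
    have := hi j
    simp [π, hj] at this
  · rw [Matrix.diagonal_mul, hd i j (hπ _ _ hij), inv_mul_cancel₀ (hπ _ _ hij).1]
  · rw [Matrix.diagonal_mul, (hπ _ _ hij).2 l hl, mul_zero]
  · rw [Matrix.diagonal_mul, hred k i j hk (hπ _ _ hij).1 (hπ _ _ hij).2, mul_zero]
  · rw [Matrix.mul_assoc, ← Matrix.mul_assoc (Matrix.diagonal d), Matrix.diagonal_mul_diagonal]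
    have : (fun i => d i * (d i)⁻¹) = fun _ => 1 := funext fun i => mul_inv_cancel₀ (hd0 i)
    rw [this, Matrix.diagonal_one, Matrix.one_mul, hV, ← Matrix.mul_assoc, hb₁b', Matrix.one_mul]

theorem IsPP.rowExtend_mem_upperBorel {α β : Type*} [Fintype α] [LinearOrder β]
    {π Z : Matrix α β ℂ} (h : IsPP π)
    (hl : ∀ i j l, π i j = 1 → l < j → Z i l = 0) (hp : ∀ i j, π i j = 1 → Z i j ≠ 0) :
    rowExtend π Z ∈ upperBorel β := by
  refine ⟨fun i j hij => h.rowExtend_isUpperTriangular hl hij, fun j => ?_⟩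
  by_cases hj : ∃ i, π i j = 1
  · obtain ⟨i, hi⟩ := hj
    rw [h.rowExtend_apply hi]
    exact hp i j hi
  · rw [rowExtend_apply_of_not_exists hj, if_pos rfl]
    exact one_ne_zero

theorem exists_bruhat (X : Matrix α β ℂ) : ∃ b ∈ lowerBorel α, ∃ c ∈ upperBorel β,
    ∃ π : Matrix α β ℂ, IsPP π ∧ X = b * π * c := by
  obtain ⟨b, hb, π, Z, hπ, hZ, rfl⟩ := exists_eq_lowerBorel_mul_isReduced X
  refine ⟨b, hb, rowExtend π Z, hπ.rowExtend_mem_upperBorel hZ.left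
    (fun i j hij => by rw [hZ.pivot i j hij]; exact one_ne_zero), π, hπ, ?_⟩
  rw [Matrix.mul_assoc, hπ.mul_rowExtend hZ.zero_row]

/-! ### Ranks of corner submatrices -/

theorem rank_cut_mul_mul_le {b : Matrix α α ℂ} (hb : b ∈ lowerBorel α) {c : Matrix β β ℂ}
    (hc : c ∈ upperBorel β) (X : Matrix α β ℂ) {s : Set α} (hs : IsLowerSet s) {t : Set β}
    (ht : IsLowerSet t) : (cut s t (b * X * c)).rank ≤ (cut s t X).rank := by
  classical
  have h1 : Matrix.diagonal (fun i => if i ∈ s then (1 : ℂ) else 0) * b =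
      Matrix.diagonal (fun i => if i ∈ s then (1 : ℂ) else 0) * b *
        Matrix.diagonal (fun i => if i ∈ s then (1 : ℂ) else 0) := by
    ext i k
    rw [Matrix.mul_diagonal, Matrix.diagonal_mul]
    by_cases hi : i ∈ s <;> by_cases hk : k ∈ s <;> simp only [hi, hk, if_true, if_false, one_mul,
      mul_one, mul_zero, zero_mul]
    exact hb.1 i k (not_le.1 fun hle => hk (hs hle hi))
  have h2 : c * Matrix.diagonal (fun i => if i ∈ t then (1 : ℂ) else 0) =
      Matrix.diagonal (fun i => if i ∈ t then (1 : ℂ) else 0) *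
        (c * Matrix.diagonal (fun i => if i ∈ t then (1 : ℂ) else 0)) := by
    ext i k
    rw [Matrix.diagonal_mul, Matrix.mul_diagonal]
    by_cases hi : i ∈ t <;> by_cases hk : k ∈ t <;> simp only [hi, hk, if_true, if_false, one_mul,
      mul_one, mul_zero, zero_mul]
    exact hc.1 i k (not_le.1 fun hle => hi (ht hle hk))
  have h3 : cut s t (b * X * c) =
      (Matrix.diagonal (fun i => if i ∈ s then (1 : ℂ) else 0) * b) * cut s t X *
        (c * Matrix.diagonal (fun i => if i ∈ t then (1 : ℂ) else 0)) := by
    rw [cut_eq_mul, cut_eq_mul]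
    simp only [← Matrix.mul_assoc]
    rw [← h1]
    simp only [Matrix.mul_assoc]
    rw [← h2]
  rw [h3]
  exact (Matrix.rank_mul_le_left _ _).trans (Matrix.rank_mul_le_right _ _)

theorem rank_cut_mul_mul {b : Matrix α α ℂ} (hb : b ∈ lowerBorel α) {c : Matrix β β ℂ}
    (hc : c ∈ upperBorel β) (X : Matrix α β ℂ) {s : Set α} (hs : IsLowerSet s) {t : Set β}
    (ht : IsLowerSet t) : (cut s t (b * X * c)).rank = (cut s t X).rank := by
  refine le_antisymm (rank_cut_mul_mul_le hb hc X hs ht) ?_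
  obtain ⟨b', hb', -, hb1⟩ := exists_inv_of_mem_lowerBorel hb
  obtain ⟨c', hc', hc1, -⟩ := exists_inv_of_mem_upperBorel hc
  have h := rank_cut_mul_mul_le hb' hc' (b * X * c) hs ht
  have h1 : b' * (b * X * c) * c' = X := by
    rw [Matrix.mul_assoc, Matrix.mul_assoc (b * X), hc1, Matrix.mul_one, ← Matrix.mul_assoc, hb1,
      Matrix.one_mul]
  rwa [h1] at h

/-- In row `i`, the partial permutation matrix has a one in the columns `t` exactly when the corner
rank jumps at `i`. -/
theorem IsPP.rank_cut_Iic {α β : Type*} [LinearOrder α] [Fintype α] [Fintype β]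
    {π : Matrix α β ℂ} (h : IsPP π) (i : α) (t : Set β) :
    (cut (Set.Iic i) t π).rank = (cut (Set.Iio i) t π).rank +
      (open Classical in if ∃ j ∈ t, π i j = 1 then 1 else 0) := by
  classical
  rw [(h.isPP_cut _ _).rank_eq, (h.isPP_cut _ _).rank_eq]
  simp only [cut_apply_eq_one_iff, exists_and_left, Set.mem_Iic, Set.mem_Iio]
  split_ifs with hi
  · rw [← Finset.card_insert_of_notMem (a := i) (by simp)]
    congr 1
    ext k
    simp only [Finset.mem_filter, Finset.mem_univ, true_and, Finset.mem_insert]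
    constructor
    · rintro ⟨h1, h2⟩
      rcases h1.eq_or_lt with rfl | h1
      · exact Or.inl rfl
      · exact Or.inr ⟨h1, h2⟩
    · rintro (rfl | ⟨h1, h2⟩)
      · exact ⟨le_rfl, hi⟩
      · exact ⟨h1.le, h2⟩
  · rw [add_zero]
    congr 1
    ext k
    simp only [Finset.mem_filter, Finset.mem_univ, true_and]
    constructor
    · rintro ⟨h1, h2⟩
      refine ⟨lt_of_le_of_ne h1 ?_, h2⟩
      rintro rfl
      exact hi h2
    · rintro ⟨h1, h2⟩
      exact ⟨h1.le, h2⟩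

/-- A partial permutation matrix is determined by its corner ranks: the one in row `i`, if there is
one, is in column `j` exactly when the columns up to `j` contain it and those before `j` do not. -/
theorem IsPP.eq_of_rank_cut_eq {π π' : Matrix α β ℂ} (h : IsPP π) (h' : IsPP π')
    (hr : ∀ (s : Set α) (t : Set β), IsLowerSet s → IsLowerSet t →
      (cut s t π).rank = (cut s t π').rank) : π = π' := by
  have key : ∀ (i : α) (t : Set β), IsLowerSet t → ((∃ j ∈ t, π i j = 1) ↔ ∃ j ∈ t, π' i j = 1) := by
    intro i t ht
    have h1 := h.rank_cut_Iic i t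
    have h2 := h'.rank_cut_Iic i t
    rw [hr _ _ (isLowerSet_Iic i) ht, hr _ _ (isLowerSet_Iio i) ht, h2] at h1
    have h3 := Nat.add_left_cancel h1
    refine ⟨fun h4 => by_contra fun h5 => ?_, fun h4 => by_contra fun h5 => ?_⟩
    · rw [if_neg h5, if_pos h4] at h3
      exact zero_ne_one h3
    · rw [if_pos h4, if_neg h5] at h3
      exact one_ne_zero h3
  have key2 : ∀ (ρ : Matrix α β ℂ), IsPP ρ → ∀ i j, ρ i j = 1 ↔
      (∃ l ∈ Set.Iic j, ρ i l = 1) ∧ ¬ ∃ l ∈ Set.Iio j, ρ i l = 1 := by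
    intro ρ hρ i j
    constructor
    · refine fun h1 => ⟨⟨j, le_rfl, h1⟩, ?_⟩
      rintro ⟨l, hl, h2⟩
      exact (ne_of_lt hl) (hρ.2.1 i l j h2 h1)
    · rintro ⟨⟨l, hl, h1⟩, h2⟩
      rcases (Set.mem_Iic.1 hl).eq_or_lt with rfl | hl
      · exact h1
      · exact absurd ⟨l, hl, h1⟩ h2
  ext i j
  have h1 : π i j = 1 ↔ π' i j = 1 := by
    rw [key2 π h, key2 π' h', key i _ (isLowerSet_Iic j), key i _ (isLowerSet_Iio j)]
  rcases h.1 i j with h0 | h0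
  · rcases h'.1 i j with h0' | h0'
    · rw [h0, h0']
    · rw [h1.2 h0', h0']
  · rw [h0, h1.1 h0]

theorem IsPP.eq_of_mul_mul_eq {π π' : Matrix α β ℂ} (h : IsPP π) (h' : IsPP π')
    {b b' : Matrix α α ℂ} {c c' : Matrix β β ℂ} (hb : b ∈ lowerBorel α) (hb' : b' ∈ lowerBorel α)
    (hc : c ∈ upperBorel β) (hc' : c' ∈ upperBorel β) (he : b * π * c = b' * π' * c') : π = π' :=
  h.eq_of_rank_cut_eq h' fun s t hs ht => by
    rw [← rank_cut_mul_mul hb hc π hs ht, he, rank_cut_mul_mul hb' hc' π' hs ht]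

/-- The corner ranks characterise the double coset of a partial permutation matrix. -/
theorem IsPP.exists_eq_mul_mul {π : Matrix α β ℂ} (h : IsPP π) {X : Matrix α β ℂ}
    (hr : ∀ (s : Set α) (t : Set β), IsLowerSet s → IsLowerSet t →
      (cut s t X).rank = (cut s t π).rank) :
    ∃ b ∈ lowerBorel α, ∃ c ∈ upperBorel β, X = b * π * c := by
  obtain ⟨b, hb, c, hc, τ, hτ, rfl⟩ := exists_bruhat X
  obtain rfl : τ = π := hτ.eq_of_rank_cut_eq h fun s t hs ht => by
    rw [← hr s t hs ht, rank_cut_mul_mul hb hc τ hs ht]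
  exact ⟨b, hb, c, hc, rfl⟩

/-- The same characterisation for the opposite order of rows and columns. -/
theorem IsPP.exists_eq_mul_mul_of_upper {π : Matrix α β ℂ} (h : IsPP π) {X : Matrix α β ℂ}
    (hr : ∀ (s : Set α) (t : Set β), IsUpperSet s → IsUpperSet t →
      (cut s t X).rank = (cut s t π).rank) :
    ∃ c ∈ upperBorel α, ∃ b ∈ lowerBorel β, X = c * π * b := by
  obtain ⟨c, hc, b, hb, he⟩ := IsPP.exists_eq_mul_mul (α := αᵒᵈ) (β := βᵒᵈ) (π := π) h (X := X)
    fun s t hs ht => hr s t (fun a b hab ha => hs (a := a) (b := b) hab ha)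
      (fun a b hab ha => ht (a := a) (b := b) hab ha)
  exact ⟨c, ⟨fun i j hij => hc.1 i j hij, hc.2⟩, b, ⟨fun i j hij => hb.1 i j hij, hb.2⟩, he⟩

end Bruhat

/-! ### Pairs of matrices with triangular products -/

section Pairs

variable {m n : ℕ}

theorem mem_borelOrbit_iff {π X : Matrix (Fin m) (Fin n) ℂ} :
    X ∈ borelOrbit π ↔ ∃ b ∈ lowerBorel (Fin m), ∃ c ∈ upperBorel (Fin n), X = b * π * c := by
  constructor
  · rintro ⟨b, c, hb, hc, rfl⟩
    have hb' : b.val ∈ lowerBorel (Fin m) := mem_lowerBorel_of_det_ne_zero hb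
      ((Matrix.isUnit_iff_isUnit_det _).1 b.isUnit).ne_zero
    have hc' : c.val ∈ upperBorel (Fin n) := mem_upperBorel_of_det_ne_zero hc
      ((Matrix.isUnit_iff_isUnit_det _).1 c.isUnit).ne_zero
    obtain ⟨d, hd, -, hdc⟩ := exists_inv_of_mem_upperBorel hc'
    have hdc' : (c⁻¹).val = d := by
      have h1 : c.val * (c⁻¹).val = 1 := c.mul_inv
      rw [← Matrix.one_mul (c⁻¹).val, ← hdc, Matrix.mul_assoc, h1, Matrix.mul_one]
    exact ⟨b.val, hb', d, hd, by rw [hdc']⟩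
  · rintro ⟨b, hb, c, hc, rfl⟩
    obtain ⟨b', -, h1, h2⟩ := exists_inv_of_mem_lowerBorel hb
    obtain ⟨c', hc', h3, h4⟩ := exists_inv_of_mem_upperBorel hc
    exact ⟨⟨b, b', h1, h2⟩, ⟨c', c, h4, h3⟩, hb.1, hc'.1, rfl⟩

theorem IsLowerUpper.conj {X : Matrix (Fin m) (Fin n) ℂ} {Y : Matrix (Fin n) (Fin m) ℂ}
    (h : IsLowerUpper X Y) {b b' : Matrix (Fin m) (Fin m) ℂ} {c c' : Matrix (Fin n) (Fin n) ℂ}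
    (hb : b ∈ lowerBorel (Fin m)) (hb' : b' ∈ lowerBorel (Fin m)) (hbb : b' * b = 1)
    (hc : c ∈ upperBorel (Fin n)) (hc' : c' ∈ upperBorel (Fin n)) (hcc : c * c' = 1) :
    IsLowerUpper (b * X * c) (c' * Y * b') := by
  have h1 : b * X * c * (c' * Y * b') = b * (X * Y) * b' := by
    rw [Matrix.mul_assoc c', Matrix.mul_assoc (b * X), ← Matrix.mul_assoc c, hcc, Matrix.one_mul]
    simp only [Matrix.mul_assoc]
  have h2 : c' * Y * b' * (b * X * c) = c' * (Y * X) * c := by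
    rw [Matrix.mul_assoc b, Matrix.mul_assoc (c' * Y), ← Matrix.mul_assoc b', hbb, Matrix.one_mul]
    simp only [Matrix.mul_assoc]
  have hbl : b.IsLowerTriangular := fun i j hij => hb.1 i j hij
  have hbl' : b'.IsLowerTriangular := fun i j hij => hb'.1 i j hij
  have hcu : c.IsUpperTriangular := fun i j hij => hc.1 i j hij
  have hcu' : c'.IsUpperTriangular := fun i j hij => hc'.1 i j hij
  have hl : (X * Y).IsLowerTriangular := fun i j hij => h.1 i j hij
  have hu : (Y * X).IsUpperTriangular := fun i j hij => h.2 i j hij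
  exact ⟨fun i j hij => h1 ▸ ((hbl.mul hl).mul hbl') hij,
    fun i j hij => h2 ▸ ((hcu'.mul hu).mul hcu) hij⟩

theorem IsLowerUpper.add_smul_left {X X' : Matrix (Fin m) (Fin n) ℂ}
    {Y : Matrix (Fin n) (Fin m) ℂ} (h : IsLowerUpper X Y) (h' : IsLowerUpper X' Y) (t : ℂ) :
    IsLowerUpper (X + t • X') Y := by
  refine ⟨fun i j hij => ?_, fun i j hij => ?_⟩
  · rw [Matrix.add_mul, Matrix.smul_mul, Matrix.add_apply, Matrix.smul_apply, h.1 i j hij,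
      h'.1 i j hij, smul_zero, add_zero]
  · rw [Matrix.mul_add, Matrix.mul_smul, Matrix.add_apply, Matrix.smul_apply, h.2 i j hij,
      h'.2 i j hij, smul_zero, add_zero]

theorem IsLowerUpper.add_smul_right {X : Matrix (Fin m) (Fin n) ℂ}
    {Y Y' : Matrix (Fin n) (Fin m) ℂ} (h : IsLowerUpper X Y) (h' : IsLowerUpper X Y') (t : ℂ) :
    IsLowerUpper X (Y + t • Y') := by
  refine ⟨fun i j hij => ?_, fun i j hij => ?_⟩
  · rw [Matrix.mul_add, Matrix.mul_smul, Matrix.add_apply, Matrix.smul_apply, h.1 i j hij,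
      h'.1 i j hij, smul_zero, add_zero]
  · rw [Matrix.add_mul, Matrix.smul_mul, Matrix.add_apply, Matrix.smul_apply, h.2 i j hij,
      h'.2 i j hij, smul_zero, add_zero]

/-- The conditions on the fibre over a partial permutation matrix say that certain entries of `Y`
vanish; here are those to the right of a pivot of `πᵀ`. -/
theorem IsLowerUpper.apply_eq_zero_of_row {π : Matrix (Fin m) (Fin n) ℂ}
    {Y : Matrix (Fin n) (Fin m) ℂ} (h : IsLowerUpper π Y) (hπ : IsPP π) {i k : Fin m} {j : Fin n}
    (hij : π i j = 1) (hik : i < k) : Y j k = 0 := by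
  rw [← hπ.mul_apply hij Y k]
  exact h.1 i k hik

/-- The entries of `Y` below a pivot of `πᵀ` vanish. -/
theorem IsLowerUpper.apply_eq_zero_of_col {π : Matrix (Fin m) (Fin n) ℂ}
    {Y : Matrix (Fin n) (Fin m) ℂ} (h : IsLowerUpper π Y) (hπ : IsPP π) {i : Fin m} {j l : Fin n}
    (hij : π i j = 1) (hjl : j < l) : Y l i = 0 := by
  rw [← hπ.apply_mul hij Y l]
  exact h.2 l j hjl

theorem IsPP.isLowerUpper_transpose {π ρ : Matrix (Fin m) (Fin n) ℂ} (hπ : IsPP π) (hρ : IsPP ρ)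
    (hle : ∀ i j, π i j = 1 → ρ i j = 1) : IsLowerUpper π ρᵀ := by
  refine ⟨fun i k hik => ?_, fun j l hjl => ?_⟩
  · by_cases hi : ∃ j, π i j = 1
    · obtain ⟨j, hj⟩ := hi
      rw [hπ.mul_apply hj, Matrix.transpose_apply, hρ.eq_zero_of_right (hle i j hj) hik.ne']
    · exact mul_apply_of_row_eq_zero
        (fun j => (hπ.1 i j).resolve_right fun h1 => hi ⟨j, h1⟩) _ _
  · by_cases hl : ∃ i, π i l = 1
    · obtain ⟨i, hi⟩ := hl
      rw [hπ.apply_mul hi, Matrix.transpose_apply, hρ.eq_zero_of_left (hle i l hi) hjl.ne']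
    · rw [Matrix.mul_apply]
      refine Finset.sum_eq_zero fun i _ => ?_
      rw [(hπ.1 i l).resolve_right fun h1 => hl ⟨i, h1⟩, mul_zero]

theorem IsPP.rank_eq_iff {π : Matrix (Fin m) (Fin n) ℂ} (hπ : IsPP π) :
    π.rank = m ↔ ∀ i, ∃ j, π i j = 1 := by
  classical
  have h1 := hπ.card_zeroRow_add_rank (fun i => ∀ j, π i j = 0) fun i => Iff.rfl
  rw [Fintype.card_fin] at h1
  have h2 : π.rank = m ↔ (Finset.univ.filter fun i => ∀ j, π i j = 0).card = 0 := by omega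
  rw [h2, Finset.card_eq_zero, Finset.filter_eq_empty_iff]
  refine ⟨fun h i => ?_, fun h i _ hi => ?_⟩
  · obtain ⟨j, hj⟩ := not_forall.1 (h (Finset.mem_univ i))
    exact ⟨j, (hπ.1 i j).resolve_left hj⟩
  · obtain ⟨j, hj⟩ := h i
    rw [hi j] at hj
    exact zero_ne_one hj

/-- A polynomial vanishing at almost all points of a line vanishes at its origin. -/
theorem eval_coords_eq_zero_of_line (f : MvPolynomial (Coord m n) ℂ)
    (X X' : Matrix (Fin m) (Fin n) ℂ) (Y Y' : Matrix (Fin n) (Fin m) ℂ)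
    (h : {s : ℂ | MvPolynomial.eval (coords (X + s • X') (Y + s • Y')) f ≠ 0}.Finite) :
    MvPolynomial.eval (coords X Y) f = 0 := by
  let g : Polynomial ℂ := MvPolynomial.aeval
    (fun k => Polynomial.C (coords X Y k) + Polynomial.X * Polynomial.C (coords X' Y' k)) f
  have hg : ∀ s, g.eval s = MvPolynomial.eval (coords (X + s • X') (Y + s • Y')) f := by
    intro s
    have h1 : (Polynomial.evalRingHom s).comp (MvPolynomial.aeval
        (fun k => Polynomial.C (coords X Y k) + Polynomial.X * Polynomial.C (coords X' Y' k)) :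
          MvPolynomial (Coord m n) ℂ →ₐ[ℂ] Polynomial ℂ).toRingHom =
        MvPolynomial.eval (coords (X + s • X') (Y + s • Y')) := by
      refine MvPolynomial.ringHom_ext (fun a => by simp) fun k => ?_
      rcases k with k | k <;> simp [coords] <;> ring
    exact congrArg (fun φ : MvPolynomial (Coord m n) ℂ →+* ℂ => φ f) h1
  have hg0 : g = 0 := by
    refine Polynomial.eq_zero_of_infinite_isRoot g ?_
    refine (h.infinite_compl).mono fun s hs => ?_
    change g.eval s = 0
    rw [hg]
    simpa using hs
  have := hg 0
  rw [hg0] at this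
  simpa using this.symm

end Pairs

/-! ### The completion of a partial permutation matrix -/

section Counting

variable {α : Type*} [LinearOrder α] [Fintype α] (P : α → Prop)

open Classical in
theorem card_filter_le_add_of_isUpperSet {s : Set α} (hs : IsUpperSet s) {x : α} (hx : x ∈ s) :
    (Finset.univ.filter P).card ≤ (Finset.univ.filter fun y => y < x ∧ P y).card +
      (Finset.univ.filter fun y => y ∈ s ∧ P y).card := by
  refine le_trans (Finset.card_le_card fun y hy => ?_) (Finset.card_union_le _ _)
  simp only [Finset.mem_filter, Finset.mem_univ, true_and, Finset.mem_union] at hy ⊢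
  rcases lt_or_ge y x with h | h
  · exact Or.inl ⟨h, hy⟩
  · exact Or.inr ⟨hs h hx, hy⟩

open Classical in
theorem add_card_filter_lt_of_isUpperSet {s : Set α} (hs : IsUpperSet s) {x : α} (hx : x ∉ s)
    (hP : P x) : (Finset.univ.filter fun y => y < x ∧ P y).card +
      (Finset.univ.filter fun y => y ∈ s ∧ P y).card < (Finset.univ.filter P).card := by
  have hlt : ∀ y ∈ s, x < y := fun y hy => not_le.1 fun hle => hx (hs hle hy)
  rw [← Finset.card_union_of_disjoint]
  · refine Finset.card_lt_card ⟨fun y hy => ?_, fun hsub => ?_⟩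
    · simp only [Finset.mem_filter, Finset.mem_univ, true_and, Finset.mem_union] at hy ⊢
      rcases hy with hy | hy
      · exact hy.2
      · exact hy.2
    · have h1 : x ∈ (Finset.univ.filter P) := by simpa using hP
      have h2 := hsub h1
      simp only [Finset.mem_filter, Finset.mem_univ, true_and, Finset.mem_union] at h2
      rcases h2 with h2 | h2
      · exact lt_irrefl _ h2.1
      · exact hx h2.1
  · rw [Finset.disjoint_left]
    intro y hy hy'
    simp only [Finset.mem_filter, Finset.mem_univ, true_and] at hy hy'
    exact lt_asymm hy.1 (hlt y hy'.1)

open Classical in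
theorem card_filter_lt_injOn {x y : α} (hx : P x) (hy : P y)
    (h : (Finset.univ.filter fun z => z < x ∧ P z).card =
      (Finset.univ.filter fun z => z < y ∧ P z).card) : x = y := by
  have key : ∀ x y : α, P x → x < y → (Finset.univ.filter fun z => z < x ∧ P z).card <
      (Finset.univ.filter fun z => z < y ∧ P z).card := by
    intro x y hx hxy
    refine Finset.card_lt_card ⟨fun z hz => ?_, fun hsub => ?_⟩
    · simp only [Finset.mem_filter, Finset.mem_univ, true_and] at hz ⊢
      exact ⟨hz.1.trans hxy, hz.2⟩
    · have h1 : x ∈ (Finset.univ.filter fun z => z < y ∧ P z) := by simpa using ⟨hxy, hx⟩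
      have h2 := hsub h1
      simp at h2
  rcases lt_trichotomy x y with h1 | h1 | h1
  · exact absurd h (key x y hx h1).ne
  · exact h1
  · exact absurd h (key y x hy h1).ne'

open Classical in
theorem exists_card_filter_lt_eq {r : ℕ} (hr : r < (Finset.univ.filter P).card) :
    ∃ x, P x ∧ (Finset.univ.filter fun z => z < x ∧ P z).card = r := by
  obtain ⟨x, hx, h1⟩ := Finset.surj_on_of_inj_on_of_card_le (s := Finset.univ.filter P)
    (t := Finset.range (Finset.univ.filter P).card)
    (fun x _ => (Finset.univ.filter fun z => z < x ∧ P z).card)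
    (fun x hx => by
      have h2 := add_card_filter_lt_of_isUpperSet P (isUpperSet_empty (α := α))
        (Set.notMem_empty x) (by simpa using hx)
      simp only [Set.mem_empty_iff_false, false_and, Finset.filter_false, Finset.card_empty,
        add_zero] at h2
      exact Finset.mem_range.2 h2)
    (fun x y hx hy h => card_filter_lt_injOn P (by simpa using hx) (by simpa using hy) h)
    (by simp) r (Finset.mem_range.2 hr)
  exact ⟨x, by simpa using hx, h1.symm⟩

end Counting

section Completion

variable {m n : ℕ} {π : Matrix (Fin m) (Fin n) ℂ}

open Classical in
theorem completion_apply_eq_one_iff {i : Fin m} {j : Fin n} : completion π i j = 1 ↔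
    π i j = 1 ∨ (IsZeroRow π i ∧ IsZeroCol π j ∧
      n + (Finset.univ.filter fun i' : Fin m => i' < i ∧ IsZeroRow π i').card =
        m + (Finset.univ.filter fun j' : Fin n => j' < j ∧ IsZeroCol π j').card) := by
  simp only [completion, Matrix.of_apply]
  split_ifs with h
  · exact iff_of_true rfl h
  · exact iff_of_false zero_ne_one h

theorem IsPP.isPP_completion (hπ : IsPP π) : IsPP (completion π) := by
  classical
  refine ⟨fun i j => ?_, fun i j j' h1 h2 => ?_, fun i i' j h1 h2 => ?_⟩
  · simp only [completion, Matrix.of_apply]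
    split_ifs
    · exact Or.inr rfl
    · exact Or.inl rfl
  · rw [completion_apply_eq_one_iff] at h1 h2
    rcases h1 with h1 | ⟨h1, h1', h1''⟩ <;> rcases h2 with h2 | ⟨h2, h2', h2''⟩
    · exact hπ.2.1 i j j' h1 h2
    · exact absurd (h2 j) (by rw [h1]; exact one_ne_zero)
    · exact absurd (h1 j') (by rw [h2]; exact one_ne_zero)
    · exact card_filter_lt_injOn _ h1' h2' (Nat.add_left_cancel (h1''.symm.trans h2''))
  · rw [completion_apply_eq_one_iff] at h1 h2
    rcases h1 with h1 | ⟨h1, h1', h1''⟩ <;> rcases h2 with h2 | ⟨h2, h2', h2''⟩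
    · exact hπ.2.2 i i' j h1 h2
    · exact absurd (h2' i) (by rw [h1]; exact one_ne_zero)
    · exact absurd (h1' i') (by rw [h2]; exact one_ne_zero)
    · exact card_filter_lt_injOn _ h1 h2 (Nat.add_left_cancel (h1''.trans h2''.symm))

open Classical in
/-- Both numbers of nonzero rows and of nonzero columns are the rank. -/
theorem IsPP.add_card_zeroRow_eq (hπ : IsPP π) :
    n + (Finset.univ.filter (IsZeroRow π)).card =
      m + (Finset.univ.filter (IsZeroCol π)).card := by
  have h1 := hπ.card_zeroRow_add_rank (IsZeroRow π) fun i => Iff.rfl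
  have h2 := hπ.transpose.card_zeroRow_add_rank (IsZeroCol π) fun j => Iff.rfl
  rw [Fintype.card_fin] at h1 h2
  rw [Matrix.rank_transpose] at h2
  omega

theorem IsPP.exists_completion_row (hπ : IsPP π) (hmn : m ≤ n) (i : Fin m) :
    ∃ j, completion π i j = 1 := by
  classical
  by_cases hi : ∃ j, π i j = 1
  · obtain ⟨j, hj⟩ := hi
    exact ⟨j, completion_apply_eq_one_iff.2 (Or.inl hj)⟩
  · have hz : IsZeroRow π i := fun j => (hπ.1 i j).resolve_right fun h1 => hi ⟨j, h1⟩
    have h1 := hπ.add_card_zeroRow_eq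
    have h2 := add_card_filter_lt_of_isUpperSet (IsZeroRow π) (isUpperSet_empty (α := Fin m))
        (Set.notMem_empty i) hz
    obtain ⟨j, hj, h3⟩ := exists_card_filter_lt_eq (IsZeroCol π)
      (r := n + (Finset.univ.filter fun i' : Fin m => i' < i ∧ IsZeroRow π i').card - m) (by omega)
    exact ⟨j, completion_apply_eq_one_iff.2 (Or.inr ⟨hz, hj, by omega⟩)⟩

theorem rank_le_rank_of_col {α β : Type*} [Fintype α] [Fintype β] {A B : Matrix α β ℂ}
    (hB : IsPP B) (h : ∀ i j, A i j ≠ 0 → ∃ i', B i' j = 1) : A.rank ≤ B.rank := by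
  classical
  rw [← Matrix.rank_transpose, hB.rank_eq']
  refine Matrix.rank_le_card_of_support_subset _ _ fun j hj => ?_
  obtain ⟨i, hi⟩ := Function.ne_iff.1 hj
  simpa using h i j hi

theorem rank_le_rank_of_row {α β : Type*} [Fintype α] [Fintype β] {A B : Matrix α β ℂ}
    (hB : IsPP B) (h : ∀ i j, A i j ≠ 0 → ∃ j', B i j' = 1) : A.rank ≤ B.rank := by
  rw [← Matrix.rank_transpose, ← Matrix.rank_transpose B]
  exact rank_le_rank_of_col hB.transpose fun j i hij => h i j hij

/-- In each lower right corner, all elements of the fibre over `π` translated by multiples of the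
transpose of the completion have at most the rank of the latter. Depending on whether the corner
meets fewer zero rows or fewer zero columns of `π`, this follows by counting the nonzero columns or
the nonzero rows of the corner. -/
theorem IsLowerUpper.rank_cut_le (hπ : IsPP π) (hmn : m ≤ n) {Y : Matrix (Fin n) (Fin m) ℂ}
    (h : IsLowerUpper π Y) (z : ℂ) {t : Set (Fin n)} {s : Set (Fin m)} (ht : IsUpperSet t)
    (hs : IsUpperSet s) :
    (cut t s (Y + z • (completion π)ᵀ)).rank ≤ (cut t s (completion π)ᵀ).rank := by
  classical
  have hρ := hπ.isPP_completion
  have hle : ∀ i j, π i j = 1 → completion π i j = 1 := fun i j hij =>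
    completion_apply_eq_one_iff.2 (Or.inl hij)
  have hB : IsPP (cut t s (completion π)ᵀ) := hρ.transpose.isPP_cut t s
  have hcut : ∀ j i, cut t s (Y + z • (completion π)ᵀ) j i ≠ 0 →
      j ∈ t ∧ i ∈ s ∧ Y j i + z * completion π i j ≠ 0 := by
    intro j i hne
    simp only [cut, Matrix.of_apply] at hne
    split_ifs at hne with hm
    · exact ⟨hm.1, hm.2, by simpa using hne⟩
    · exact absurd rfl hne
  have htot := hπ.add_card_zeroRow_eq
  rcases le_total (Finset.univ.filter fun i => i ∈ s ∧ IsZeroRow π i).card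
    (Finset.univ.filter fun j => j ∈ t ∧ IsZeroCol π j).card with hc | hc
  · refine rank_le_rank_of_col hB fun j i hji => ?_
    obtain ⟨hj, hi, hne⟩ := hcut j i hji
    by_cases hz : ∃ l, π i l = 1
    · obtain ⟨l, hl⟩ := hz
      refine ⟨l, cut_apply_eq_one_iff.2 ⟨?_, hi, hle i l hl⟩⟩
      refine ht (not_lt.1 fun hlj => hne ?_) hj
      rw [h.apply_eq_zero_of_col hπ hl hlj, hρ.eq_zero_of_left (hle i l hl) hlj.ne', mul_zero,
        add_zero]
    · obtain ⟨l, hl⟩ := hπ.exists_completion_row hmn i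
      obtain ⟨hrow, hcol, heq⟩ := (completion_apply_eq_one_iff.1 hl).resolve_left
        fun h1 => hz ⟨l, h1⟩
      refine ⟨l, cut_apply_eq_one_iff.2 ⟨?_, hi, hl⟩⟩
      by_contra hlt
      have h1 := card_filter_le_add_of_isUpperSet (IsZeroRow π) hs hi
      have h2 := add_card_filter_lt_of_isUpperSet (IsZeroCol π) ht hlt hcol
      omega
  · refine rank_le_rank_of_row hB fun j i hji => ?_
    obtain ⟨hj, hi, hne⟩ := hcut j i hji
    by_cases hz : ∃ k, π k j = 1
    · obtain ⟨k, hk⟩ := hz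
      refine ⟨k, cut_apply_eq_one_iff.2 ⟨hj, ?_, hle k j hk⟩⟩
      refine hs (not_lt.1 fun hki => hne ?_) hi
      rw [h.apply_eq_zero_of_row hπ hk hki, hρ.eq_zero_of_right (hle k j hk) hki.ne', mul_zero,
        add_zero]
    · have hcol : IsZeroCol π j := fun k => (hπ.1 k j).resolve_right fun h1 => hz ⟨k, h1⟩
      have h1 := card_filter_le_add_of_isUpperSet (IsZeroCol π) ht hj
      have h2 := add_card_filter_lt_of_isUpperSet (IsZeroCol π) (isUpperSet_empty (α := Fin n))
        (Set.notMem_empty j) hcol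
      have h3 : (Finset.univ.filter fun i => i ∈ s ∧ IsZeroRow π i).card ≤
          (Finset.univ.filter (IsZeroRow π)).card :=
        Finset.card_le_card fun k hk => by simp at hk ⊢; exact hk.2
      obtain ⟨k, hk, h4⟩ := exists_card_filter_lt_eq (IsZeroRow π)
        (r := m + (Finset.univ.filter fun j' : Fin n => j' < j ∧ IsZeroCol π j').card - n)
        (by omega)
      refine ⟨k, cut_apply_eq_one_iff.2 ⟨hj, ?_,
        completion_apply_eq_one_iff.2 (Or.inr ⟨hk, hcol, by omega⟩)⟩⟩
      by_contra hks
      have h5 := add_card_filter_lt_of_isUpperSet (IsZeroRow π) hs hks hk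
      omega

/-- On a generic point of the line through `Y` in the direction of the transposed completion, all lower
right corner ranks are those of this transpose: they are not larger by counting, and not smaller by
genericity, the number of corners being finite. -/
theorem IsLowerUpper.finite_setOf_not_exists_eq_mul_mul (hπ : IsPP π) (hmn : m ≤ n)
    {Y : Matrix (Fin n) (Fin m) ℂ} (h : IsLowerUpper π Y) :
    {z : ℂ | ¬ ∃ c ∈ upperBorel (Fin n), ∃ b ∈ lowerBorel (Fin m),
      Y + z • (completion π)ᵀ = c * (completion π)ᵀ * b}.Finite := by
  have hρ := hπ.isPP_completion
  have hfin : (⋃ p : Set (Fin n) × Set (Fin m), {z : ℂ | (cut p.1 p.2 Y +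
      z • cut p.1 p.2 (completion π)ᵀ).rank < (cut p.1 p.2 (completion π)ᵀ).rank}).Finite :=
    Set.finite_iUnion fun p => (hρ.transpose.isPP_cut p.1 p.2).finite_rank_add_smul_lt _
  refine hfin.subset fun z hz => ?_
  by_contra hcon
  simp only [Set.mem_iUnion, not_exists, Set.mem_ofPred_eq, not_lt] at hcon
  refine hz (hρ.transpose.exists_eq_mul_mul_of_upper fun t s ht hs =>
    le_antisymm (h.rank_cut_le hπ hmn z ht hs) ?_)
  refine (hcon (t, s)).trans_eq ?_
  congr 1
  ext j i
  simp only [cut, Matrix.of_apply, Matrix.add_apply, Matrix.smul_apply]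
  split_ifs <;> simp

end Completion

/-! ### Degenerations between the strata -/

section Degeneration

variable {m n : ℕ}

/-- Pairs whose second matrix is in the double coset of the transpose of `ρ` are limits of pairs
whose first matrix is in that of `ρ`: after conjugation the second matrix is the transpose of `ρ`,
and adding a multiple of `ρ` to the first one makes all its pivots nonzero. -/
theorem IsPP.eval_eq_zero_of_right {ρ : Matrix (Fin m) (Fin n) ℂ} (hρ : IsPP ρ)
    (hrow : ∀ i, ∃ j, ρ i j = 1) (f : MvPolynomial (Coord m n) ℂ)
    (hf : ∀ X Y, IsLowerUpper X Y → X ∈ borelOrbit ρ → MvPolynomial.eval (coords X Y) f = 0)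
    {X : Matrix (Fin m) (Fin n) ℂ} {Y : Matrix (Fin n) (Fin m) ℂ} (h : IsLowerUpper X Y)
    {c : Matrix (Fin n) (Fin n) ℂ} (hc : c ∈ upperBorel (Fin n)) {b : Matrix (Fin m) (Fin m) ℂ}
    (hb : b ∈ lowerBorel (Fin m)) (hY : Y = c * ρᵀ * b) :
    MvPolynomial.eval (coords X Y) f = 0 := by
  obtain ⟨c', hc', hcc', hc'c⟩ := exists_inv_of_mem_upperBorel hc
  obtain ⟨b', hb', hbb', hb'b⟩ := exists_inv_of_mem_lowerBorel hb
  have h1 : IsLowerUpper (b * X * c) ρᵀ := by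
    have h2 := h.conj hb hb' hb'b hc hc' hcc'
    rwa [hY, Matrix.mul_assoc c', Matrix.mul_assoc (c * ρᵀ), hbb', Matrix.mul_one,
      ← Matrix.mul_assoc c', hc'c, Matrix.one_mul] at h2
  set X' := b * X * c with hX'
  have hleft : ∀ i j l, ρ i j = 1 → l < j → X' i l = 0 := fun i j l hij hlj => by
    rw [← hρ.transpose.mul_apply (i := j) (j := i) hij X' l]
    exact h1.2 j l hlj
  have h2 : IsLowerUpper (b' * ρ * c') Y := by
    rw [hY]
    exact (hρ.isLowerUpper_transpose hρ fun _ _ => id).conj hb' hb hbb' hc' hc hc'c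
  refine eval_coords_eq_zero_of_line f X (b' * ρ * c') Y 0 ?_
  -- Only the values of `t` cancelling an entry of `X'` can make a pivot of `X' + t ρ` vanish.
  refine (Set.finite_range fun p : Fin m × Fin n => -X' p.1 p.2).subset fun t ht => ?_
  by_contra hcon
  refine ht ?_
  rw [smul_zero, add_zero]
  refine hf _ _ (h.add_smul_left h2 t) (mem_borelOrbit_iff.2
    ⟨b', hb', rowExtend ρ (X' + t • ρ) * c', mul_mem_upperBorel
      (hρ.rowExtend_mem_upperBorel (fun i j l hij hlj => ?_) fun i j hij h0 => ?_) hc', ?_⟩)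
  · simp [hleft i j l hij hlj, hρ.eq_zero_of_left hij hlj.ne]
  · refine hcon ⟨(i, j), ?_⟩
    rw [Matrix.add_apply, Matrix.smul_apply, hij, smul_eq_mul, mul_one] at h0
    linear_combination -h0
  · have h3 : ρ * rowExtend ρ (X' + t • ρ) = X' + t • ρ := hρ.mul_rowExtend fun i hi => by
      obtain ⟨j, hj⟩ := hrow i
      rw [hi j] at hj
      exact absurd hj zero_ne_one
    have h4 : b' * X' * c' = X := by
      rw [hX', Matrix.mul_assoc, Matrix.mul_assoc (b * X), hcc', Matrix.mul_one,
        ← Matrix.mul_assoc, hb'b, Matrix.one_mul]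
    rw [← Matrix.mul_assoc (b' * ρ), Matrix.mul_assoc b' ρ (rowExtend _ _), h3, Matrix.mul_add,
      Matrix.add_mul, h4, Matrix.mul_smul, Matrix.smul_mul]

/-- Polynomials vanishing on the stratum of the completion of `π` vanish on the stratum of `π`. For
`X = π`, a translate of `Y` by a generic multiple of the transpose of the completion lies in the
double coset of that transpose. -/
theorem IsPP.eval_eq_zero_of_completion {π : Matrix (Fin m) (Fin n) ℂ} (hπ : IsPP π) (hmn : m ≤ n)
    (f : MvPolynomial (Coord m n) ℂ)
    (hf : ∀ X Y, IsLowerUpper X Y → X ∈ borelOrbit (completion π) →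
      MvPolynomial.eval (coords X Y) f = 0)
    {X : Matrix (Fin m) (Fin n) ℂ} {Y : Matrix (Fin n) (Fin m) ℂ} (h : IsLowerUpper X Y)
    (hX : X ∈ borelOrbit π) : MvPolynomial.eval (coords X Y) f = 0 := by
  obtain ⟨b, hb, c, hc, hXe⟩ := mem_borelOrbit_iff.1 hX
  obtain ⟨c', hc', hcc', hc'c⟩ := exists_inv_of_mem_upperBorel hc
  obtain ⟨b', hb', hbb', hb'b⟩ := exists_inv_of_mem_lowerBorel hb
  have hρ := hπ.isPP_completion
  have h1 : IsLowerUpper π (c * Y * b) := by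
    have h2 := h.conj hb' hb hbb' hc' hc hc'c
    rwa [hXe, Matrix.mul_assoc b', Matrix.mul_assoc (b * π), hcc', Matrix.mul_one,
      ← Matrix.mul_assoc b', hb'b, Matrix.one_mul] at h2
  have h2 : IsLowerUpper X (c' * (completion π)ᵀ * b') := by
    rw [hXe]
    exact (hπ.isLowerUpper_transpose hρ fun i j hij =>
      completion_apply_eq_one_iff.2 (Or.inl hij)).conj hb hb' hb'b hc hc' hcc'
  refine eval_coords_eq_zero_of_line f X 0 Y (c' * (completion π)ᵀ * b') ?_
  refine (h1.finite_setOf_not_exists_eq_mul_mul hπ hmn).subset fun z hz => ?_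
  rintro ⟨c₁, hc₁, b₁, hb₁, he⟩
  refine hz ?_
  rw [smul_zero, add_zero]
  refine hρ.eval_eq_zero_of_right (hπ.exists_completion_row hmn) f hf (h.add_smul_right h2 z)
    (mul_mem_upperBorel hc' hc₁) (mul_mem_lowerBorel hb₁ hb') ?_
  have h3 : c' * (c * Y * b) * b' = Y := by
    rw [Matrix.mul_assoc c, ← Matrix.mul_assoc c', hc'c, Matrix.one_mul, Matrix.mul_assoc, hbb',
      Matrix.mul_one]
  have h4 : Y + z • (c' * (completion π)ᵀ * b') =
      c' * (c * Y * b + z • (completion π)ᵀ) * b' := by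
    rw [Matrix.mul_add, Matrix.add_mul, h3, Matrix.mul_smul, Matrix.smul_mul]
  rw [h4, he]
  simp only [Matrix.mul_assoc]

end Degeneration

/-! ### A birational parametrisation of the strata of maximal rank -/

section Param

variable {m n : ℕ}

/-- The partial permutation matrix of rank `m` with ones at the positions `(i, σ i)`. -/
noncomputable def permMat (R : Type*) [Zero R] [One R] (σ : Fin m → Fin n) : Matrix (Fin m) (Fin n) R :=
  Matrix.of fun i l => if l = σ i then 1 else 0

/-- The parameters: one for each position of an `m × n` matrix and one for each row. -/
abbrev ParamIndex (m n : ℕ) : Type := (Fin m × Fin n) ⊕ Fin m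

variable {R S : Type*} [CommRing R] [CommRing S] (σ : Fin m → Fin n)

/-- The lower triangular matrix with the row parameters on the diagonal and the parameter at
`(i, σ k)` in position `(i, k)`, for `k < i`. -/
noncomputable def lowerParam (p : ParamIndex m n → R) : Matrix (Fin m) (Fin m) R :=
  Matrix.of fun i k => if k < i then p (Sum.inl (i, σ k)) else if k = i then p (Sum.inr i) else 0

open Classical in
/-- The reduced matrix with pivots at the positions `(i, σ i)` and parameters at the positions which
are to the right of a pivot and not below one. -/
noncomputable def reducedParam (p : ParamIndex m n → R) : Matrix (Fin m) (Fin n) R :=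
  Matrix.of fun i l =>
    if l = σ i then 1
    else if σ i < l ∧ ∀ k < i, l ≠ σ k then p (Sum.inl (i, l)) else 0

open Classical in
/-- The elements of the fibre of the lower-upper scheme over the partial permutation matrix. Together,
the matrices `lowerParam`, `reducedParam` and `fibreParam` use each parameter once. -/
noncomputable def fibreParam (p : ParamIndex m n → R) : Matrix (Fin n) (Fin m) R :=
  Matrix.of fun l i => if σ i < l ∨ ∃ k < i, l = σ k then 0 else p (Sum.inl (i, l))

/-- The upper unitriangular matrix with `reducedParam` as its image under `permMat`. -/
noncomputable def upperParam (p : ParamIndex m n → R) : Matrix (Fin n) (Fin n) R :=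
  rowExtend (permMat R σ) (reducedParam σ p)

/-- The first matrix of the parametrised pair. -/
noncomputable def paramX (p : ParamIndex m n → R) : Matrix (Fin m) (Fin n) R :=
  lowerParam σ p * reducedParam σ p

/-- The second matrix of the parametrised pair; adjugates take the place of inverses in order to
have polynomial entries. -/
noncomputable def paramY (p : ParamIndex m n → R) : Matrix (Fin n) (Fin m) R :=
  (upperParam σ p).adjugate * fibreParam σ p * (lowerParam σ p).adjugate

variable {σ}

theorem permMat_apply_eq_one_iff [Nontrivial R] {i : Fin m} {l : Fin n} :
    permMat R σ i l = 1 ↔ l = σ i := by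
  simp [permMat]

theorem isPP_permMat [Nontrivial R] (hσ : Function.Injective σ) : IsPP (permMat R σ) := by
  refine ⟨fun i j => ?_, fun i j j' h1 h2 => ?_, fun i i' j h1 h2 => ?_⟩
  · simp only [permMat, Matrix.of_apply]
    split_ifs <;> simp
  · rw [permMat_apply_eq_one_iff] at h1 h2
    rw [h1, h2]
  · rw [permMat_apply_eq_one_iff] at h1 h2
    exact hσ (h1.symm.trans h2)

theorem exists_eq_permMat {π : Matrix (Fin m) (Fin n) ℂ} (hπ : IsPP π) (hr : π.rank = m) :
    ∃ σ : Fin m → Fin n, Function.Injective σ ∧ π = permMat ℂ σ := by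
  choose σ hσ using hπ.rank_eq_iff.1 hr
  refine ⟨σ, fun i i' h => hπ.2.2 i i' (σ i) (hσ i) (h ▸ hσ i'), ?_⟩
  ext i l
  simp only [permMat, Matrix.of_apply]
  split_ifs with h
  · rw [h, hσ i]
  · exact hπ.eq_zero_of_left (hσ i) h

theorem rank_permMat (hσ : Function.Injective σ) : (permMat ℂ σ).rank = m :=
  (isPP_permMat hσ).rank_eq_iff.2 fun i => ⟨σ i, permMat_apply_eq_one_iff.2 rfl⟩

theorem lowerParam_map (f : R →+* S) (p : ParamIndex m n → R) :
    (lowerParam σ p).map f = lowerParam σ (f ∘ p) := by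
  ext i k
  simp only [lowerParam, Matrix.map_apply, Matrix.of_apply]
  split_ifs <;> simp

theorem reducedParam_map (f : R →+* S) (p : ParamIndex m n → R) :
    (reducedParam σ p).map f = reducedParam σ (f ∘ p) := by
  ext i k
  simp only [reducedParam, Matrix.map_apply, Matrix.of_apply]
  split_ifs <;> simp

theorem fibreParam_map (f : R →+* S) (p : ParamIndex m n → R) :
    (fibreParam σ p).map f = fibreParam σ (f ∘ p) := by
  ext i k
  simp only [fibreParam, Matrix.map_apply, Matrix.of_apply]
  split_ifs <;> simp

theorem upperParam_map [Nontrivial R] [Nontrivial S] (hσ : Function.Injective σ) (f : R →+* S)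
    (p : ParamIndex m n → R) : (upperParam σ p).map f = upperParam σ (f ∘ p) := by
  ext j l
  rw [Matrix.map_apply, upperParam, upperParam]
  by_cases hj : ∃ i, j = σ i
  · obtain ⟨i, hi⟩ := hj
    rw [(isPP_permMat hσ).rowExtend_apply (permMat_apply_eq_one_iff.2 hi),
      (isPP_permMat hσ).rowExtend_apply (permMat_apply_eq_one_iff.2 hi), ← reducedParam_map,
      Matrix.map_apply]
  · rw [rowExtend_apply_of_not_exists (by simpa only [permMat_apply_eq_one_iff] using hj),
      rowExtend_apply_of_not_exists (by simpa only [permMat_apply_eq_one_iff] using hj)]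
    split_ifs <;> simp

theorem paramX_map (f : R →+* S) (p : ParamIndex m n → R) :
    (paramX σ p).map f = paramX σ (f ∘ p) := by
  rw [paramX, Matrix.map_mul, lowerParam_map, reducedParam_map, paramX]

theorem paramY_map [Nontrivial R] [Nontrivial S] (hσ : Function.Injective σ) (f : R →+* S)
    (p : ParamIndex m n → R) : (paramY σ p).map f = paramY σ (f ∘ p) := by
  have h1 := f.map_adjugate (upperParam σ p)
  have h2 := f.map_adjugate (lowerParam σ p)
  simp only [RingHom.mapMatrix_apply] at h1 h2
  rw [paramY, Matrix.map_mul, Matrix.map_mul, h1, h2, lowerParam_map, fibreParam_map,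
    upperParam_map hσ, paramY]

theorem reducedParam_of_lt (p : ParamIndex m n → R) {i : Fin m} {l : Fin n} (h : l < σ i) :
    reducedParam σ p i l = 0 := by
  simp only [reducedParam, Matrix.of_apply]
  rw [if_neg h.ne, if_neg fun h1 => lt_asymm h h1.1]

theorem reducedParam_pivot (p : ParamIndex m n → R) (i : Fin m) :
    reducedParam σ p i (σ i) = 1 := by
  simp [reducedParam]

theorem reducedParam_below (hσ : Function.Injective σ) (p : ParamIndex m n → R) {i k : Fin m}
    (h : i < k) : reducedParam σ p k (σ i) = 0 := by
  simp only [reducedParam, Matrix.of_apply]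
  rw [if_neg fun h1 => h.ne (hσ h1), if_neg fun h1 => h1.2 i h rfl]

theorem det_upperParam [Nontrivial R] (hσ : Function.Injective σ) (p : ParamIndex m n → R) :
    (upperParam σ p).det = 1 :=
  (isPP_permMat hσ).det_rowExtend
    (fun i j l hij hlj => reducedParam_of_lt p (permMat_apply_eq_one_iff.1 hij ▸ hlj))
    fun i j hij => by rw [permMat_apply_eq_one_iff.1 hij, reducedParam_pivot]

theorem det_lowerParam (p : ParamIndex m n → R) :
    (lowerParam σ p).det = ∏ i, p (Sum.inr i) := by
  rw [Matrix.det_of_isLowerTriangular]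
  · refine Finset.prod_congr rfl fun i _ => ?_
    simp [lowerParam]
  · intro i k hik
    have h : i < k := hik
    simp only [lowerParam, Matrix.of_apply]
    rw [if_neg h.not_gt, if_neg h.ne']

theorem permMat_mul_upperParam [Nontrivial R] (hσ : Function.Injective σ)
    (p : ParamIndex m n → R) : permMat R σ * upperParam σ p = reducedParam σ p :=
  (isPP_permMat hσ).mul_rowExtend fun i hi => by
    have h := hi (σ i)
    rw [permMat_apply_eq_one_iff.2 rfl] at h
    exact absurd h one_ne_zero

theorem lowerParam_mem_lowerBorel (p : ParamIndex m n → ℂ) (hp : ∀ i, p (Sum.inr i) ≠ 0) :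
    lowerParam σ p ∈ lowerBorel (Fin m) := by
  refine ⟨fun i k hik => ?_, fun i => ?_⟩
  · simp only [lowerParam, Matrix.of_apply]
    rw [if_neg hik.not_gt, if_neg hik.ne']
  · simpa [lowerParam] using hp i

theorem upperParam_mem_upperBorel (hσ : Function.Injective σ) (p : ParamIndex m n → ℂ) :
    upperParam σ p ∈ upperBorel (Fin n) :=
  (isPP_permMat hσ).rowExtend_mem_upperBorel
    (fun i j l hij hlj => reducedParam_of_lt p (permMat_apply_eq_one_iff.1 hij ▸ hlj))
    fun i j hij => by
      rw [permMat_apply_eq_one_iff.1 hij, reducedParam_pivot]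
      exact one_ne_zero

theorem adjugate_eq_det_smul {k : ℕ} {a a' : Matrix (Fin k) (Fin k) R} (h : a * a' = 1) :
    a.adjugate = a.det • a' := by
  rw [← Matrix.mul_one a.adjugate, ← h, ← Matrix.mul_assoc, Matrix.adjugate_mul, Matrix.smul_mul,
    Matrix.one_mul]

theorem isLowerUpper_permMat_fibreParam (hσ : Function.Injective σ) (p : ParamIndex m n → ℂ) :
    IsLowerUpper (permMat ℂ σ) (fibreParam σ p) := by
  have hπ : IsPP (permMat ℂ σ) := isPP_permMat hσ
  refine ⟨fun i k hik => ?_, fun l j hjl => ?_⟩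
  · rw [hπ.mul_apply (permMat_apply_eq_one_iff.2 rfl)]
    simp only [fibreParam, Matrix.of_apply]
    rw [if_pos (Or.inr ⟨i, hik, rfl⟩)]
  · by_cases hj : ∃ i, j = σ i
    · obtain ⟨i, rfl⟩ := hj
      rw [hπ.apply_mul (permMat_apply_eq_one_iff.2 rfl)]
      simp only [fibreParam, Matrix.of_apply]
      rw [if_pos (Or.inl hjl)]
    · rw [Matrix.mul_apply]
      refine Finset.sum_eq_zero fun i _ => ?_
      rw [permMat, Matrix.of_apply, if_neg fun h => hj ⟨i, h⟩, mul_zero]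

theorem isLowerUpper_param (hσ : Function.Injective σ) (p : ParamIndex m n → ℂ)
    (hp : ∀ i, p (Sum.inr i) ≠ 0) : IsLowerUpper (paramX σ p) (paramY σ p) := by
  have hb := lowerParam_mem_lowerBorel (σ := σ) p hp
  have hu := upperParam_mem_upperBorel hσ p
  obtain ⟨b', hb', hbb', hb'b⟩ := exists_inv_of_mem_lowerBorel hb
  obtain ⟨u', hu', huu', -⟩ := exists_inv_of_mem_upperBorel hu
  have h1 : IsLowerUpper (permMat ℂ σ) (0 + (lowerParam σ p).det • fibreParam σ p) :=
    IsLowerUpper.add_smul_right ⟨fun _ _ _ => by simp, fun _ _ _ => by simp⟩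
      (isLowerUpper_permMat_fibreParam hσ p) _
  have h2 := h1.conj hb hb' hb'b hu hu' huu'
  rw [Matrix.mul_assoc, permMat_mul_upperParam hσ] at h2
  have h3 : paramY σ p = u' * (0 + (lowerParam σ p).det • fibreParam σ p) * b' := by
    rw [paramY, adjugate_eq_det_smul huu', adjugate_eq_det_smul hbb', det_upperParam hσ, one_smul,
      zero_add, Matrix.mul_smul, Matrix.mul_smul, Matrix.smul_mul]
  rw [h3]
  exact h2

theorem paramX_mem_borelOrbit (hσ : Function.Injective σ) (p : ParamIndex m n → ℂ)
    (hp : ∀ i, p (Sum.inr i) ≠ 0) : paramX σ p ∈ borelOrbit (permMat ℂ σ) :=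
  mem_borelOrbit_iff.2 ⟨_, lowerParam_mem_lowerBorel p hp, _, upperParam_mem_upperBorel hσ p, by
    rw [Matrix.mul_assoc, permMat_mul_upperParam hσ, paramX]⟩

/-- The parameters are read off the reduction of `X` and the element of the fibre over `permMat`
which is conjugate to `Y`. -/
theorem exists_eq_param (hσ : Function.Injective σ) {X : Matrix (Fin m) (Fin n) ℂ}
    {Y : Matrix (Fin n) (Fin m) ℂ} (h : IsLowerUpper X Y) (hX : X ∈ borelOrbit (permMat ℂ σ)) :
    ∃ p : ParamIndex m n → ℂ, X = paramX σ p ∧ Y = paramY σ p := by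
  classical
  have hπ : IsPP (permMat ℂ σ) := isPP_permMat hσ
  obtain ⟨b₀, hb₀, c₀, hc₀, hX₀⟩ := mem_borelOrbit_iff.1 hX
  obtain ⟨b, hb, π, Z, hπ', hZ, hXb⟩ := exists_eq_lowerBorel_mul_isReduced X
  have hu₁ : rowExtend π Z ∈ upperBorel (Fin n) := hπ'.rowExtend_mem_upperBorel hZ.left
    fun i j hij => by rw [hZ.pivot i j hij]; exact one_ne_zero
  have hZu₁ : π * rowExtend π Z = Z := hπ'.mul_rowExtend hZ.zero_row
  obtain rfl : π = permMat ℂ σ := hπ'.eq_of_mul_mul_eq hπ hb hb₀ hu₁ hc₀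
    (by rw [Matrix.mul_assoc, hZu₁, ← hXb, hX₀])
  set u := rowExtend (permMat ℂ σ) Z with hu
  obtain ⟨b', hb', hbb', hb'b⟩ := exists_inv_of_mem_lowerBorel hb
  obtain ⟨u', hu', huu', hu'u⟩ := exists_inv_of_mem_upperBorel hu₁
  have hpiv : ∀ i, permMat ℂ σ i (σ i) = 1 := fun i => permMat_apply_eq_one_iff.2 rfl
  have hdet := det_ne_zero_of_mem_lowerBorel hb
  have h1 : IsLowerUpper (permMat ℂ σ) (u * Y * b) := by
    have h2 := h.conj hb' hb hbb' hu' hu₁ hu'u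
    rwa [hXb, ← Matrix.mul_assoc b', hb'b, Matrix.one_mul, ← hZu₁, Matrix.mul_assoc, huu',
      Matrix.mul_one] at h2
  -- A position below a pivot carries an entry of `b`, a position to the right of the pivot of its row
  -- an entry of `Z`, and the remaining ones carry the entries of the conjugate of `Y`. The factor
  -- `b.det⁻¹` compensates for the adjugate of `b` in `paramY`.
  let p : ParamIndex m n → ℂ := Sum.elim
    (fun q => if hq : ∃ k, k < q.1 ∧ q.2 = σ k then b q.1 hq.choose
      else if σ q.1 < q.2 then Z q.1 q.2 else b.det⁻¹ * (u * Y * b) q.2 q.1)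
    (fun i => b i i)
  have hplow : lowerParam σ p = b := by
    ext i k
    simp only [lowerParam, Matrix.of_apply]
    split_ifs with hki hki'
    · have hq : ∃ k', k' < i ∧ σ k = σ k' := ⟨k, hki, rfl⟩
      simp only [p, Sum.elim_inl, dif_pos hq]
      rw [← hσ hq.choose_spec.2]
    · simp [p, hki']
    · exact (hb.1 i k (lt_of_le_of_ne (not_lt.1 hki) (Ne.symm hki'))).symm
  have hpred : reducedParam σ p = Z := by
    ext i l
    simp only [reducedParam, Matrix.of_apply]
    split_ifs with hl hl'
    · rw [hl, hZ.pivot i _ (hpiv i)]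
    · have hq : ¬ ∃ k, k < i ∧ l = σ k := fun ⟨k, hk, hlk⟩ => hl'.2 k hk hlk
      simp only [p, Sum.elim_inl, dif_neg hq, if_pos hl'.1]
    · rcases lt_or_gt_of_ne hl with hlt | hgt
      · exact (hZ.left i _ l (hpiv i) hlt).symm
      · by_cases hk : ∀ k < i, l ≠ σ k
        · exact absurd ⟨hgt, hk⟩ hl'
        · push Not at hk
          obtain ⟨k, hk, rfl⟩ := hk
          exact (hZ.below k i _ (hpiv k) hk).symm
  have hpfib : fibreParam σ p = b.det⁻¹ • (u * Y * b) := by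
    ext l i
    simp only [fibreParam, Matrix.of_apply, Matrix.smul_apply, smul_eq_mul]
    split_ifs with hl
    · rcases hl with hl | ⟨k, hk, rfl⟩
      · rw [h1.apply_eq_zero_of_col hπ (hpiv i) hl, mul_zero]
      · rw [h1.apply_eq_zero_of_row hπ (hpiv k) hk, mul_zero]
    · rw [not_or] at hl
      have hq : ¬ ∃ k, k < i ∧ l = σ k := fun ⟨k, hk, hlk⟩ => hl.2 ⟨k, hk, hlk⟩
      simp only [p, Sum.elim_inl, dif_neg hq, if_neg hl.1]
  have hpu : upperParam σ p = u := by rw [upperParam, hpred, hu]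
  have hdu : u.det = 1 := by rw [← hpu, det_upperParam hσ]
  refine ⟨p, by rw [paramX, hplow, hpred, hXb], ?_⟩
  rw [paramY, hpu, hplow, hpfib, adjugate_eq_det_smul huu', adjugate_eq_det_smul hbb', hdu,
    one_smul, Matrix.mul_smul _ b.det, Matrix.mul_smul u', Matrix.smul_mul, smul_smul,
    mul_inv_cancel₀ hdet,
    one_smul, Matrix.mul_assoc u Y, ← Matrix.mul_assoc u', hu'u, Matrix.one_mul, Matrix.mul_assoc,
    hbb', Matrix.mul_one]

/-- The map on polynomial functions induced by the parametrisation. -/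
noncomputable def paramHom (σ : Fin m → Fin n) :
    MvPolynomial (Coord m n) ℂ →ₐ[ℂ] MvPolynomial (ParamIndex m n) ℂ :=
  MvPolynomial.aeval (Sum.elim (fun q => paramX σ MvPolynomial.X q.1 q.2)
    (fun q => paramY σ MvPolynomial.X q.1 q.2))

theorem eval_paramHom (hσ : Function.Injective σ) (p : ParamIndex m n → ℂ)
    (f : MvPolynomial (Coord m n) ℂ) : MvPolynomial.eval p (paramHom σ f) =
      MvPolynomial.eval (coords (paramX σ p) (paramY σ p)) f := by
  have hp : (MvPolynomial.eval p : MvPolynomial (ParamIndex m n) ℂ → ℂ) ∘ MvPolynomial.X = p :=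
    funext fun k => MvPolynomial.eval_X k
  have h1 := paramX_map (σ := σ) (MvPolynomial.eval p) MvPolynomial.X
  have h2 := paramY_map hσ (MvPolynomial.eval p) MvPolynomial.X
  rw [hp] at h1 h2
  have h3 : (MvPolynomial.eval p).comp (paramHom σ).toRingHom =
      MvPolynomial.eval (coords (paramX σ p) (paramY σ p)) := by
    refine MvPolynomial.ringHom_ext (fun a => by simp [paramHom]) fun k => ?_
    rcases k with k | k
    · simp [paramHom, coords, ← h1]
    · simp [paramHom, coords, ← h2]
  exact congrArg (fun φ : MvPolynomial (Coord m n) ℂ →+* ℂ => φ f) h3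

/-- The kernel of `paramHom` is the vanishing ideal of the stratum. The parameters with a vanishing
diagonal entry, where the second matrix may leave the fibre, are excluded by multiplying with the
product of the diagonal entries. -/
theorem paramHom_eq_zero_iff (hσ : Function.Injective σ) (f : MvPolynomial (Coord m n) ℂ) :
    paramHom σ f = 0 ↔ ∀ X Y, IsLowerUpper X Y → X ∈ borelOrbit (permMat ℂ σ) →
      MvPolynomial.eval (coords X Y) f = 0 := by
  constructor
  · intro hf X Y h hX
    obtain ⟨p, rfl, rfl⟩ := exists_eq_param hσ h hX
    rw [← eval_paramHom hσ, hf, map_zero]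
  · intro hf
    have h1 : paramHom σ f * ∏ i : Fin m, MvPolynomial.X (Sum.inr i) = 0 := by
      refine MvPolynomial.funext fun p => ?_
      rw [map_mul, map_zero, map_prod]
      by_cases hp : ∀ i, p (Sum.inr i) ≠ 0
      · rw [eval_paramHom hσ, hf _ _ (isLowerUpper_param hσ p hp) (paramX_mem_borelOrbit hσ p hp),
          zero_mul]
      · push Not at hp
        obtain ⟨i, hi⟩ := hp
        rw [Finset.prod_eq_zero (Finset.mem_univ i) (by rw [MvPolynomial.eval_X, hi]), mul_zero]
    exact (mul_eq_zero.1 h1).resolve_right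
      (Finset.prod_ne_zero_iff.2 fun i _ => MvPolynomial.X_ne_zero _)

/-- A subring closed under division containing the entries of the parametrised pair contains all
parameters; it is applied to the elements algebraic over the subring of these entries. The
columns of `lowerParam` and the rows of `reducedParam` are recovered in turn from `paramX`, and
afterwards `fibreParam` from `paramY`. -/
theorem param_mem_of_division_closed [IsDomain R] (hσ : Function.Injective σ)
    (p : ParamIndex m n → R) (hp : ∀ i, p (Sum.inr i) ≠ 0) {T : Type*} [SetLike T R]
    [SubringClass T R] (A : T) (hA : ∀ y z, y ≠ 0 → y ∈ A → y * z ∈ A → z ∈ A)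
    (hX : ∀ i l, paramX σ p i l ∈ A) (hY : ∀ l i, paramY σ p l i ∈ A) (k : ParamIndex m n) :
    p k ∈ A := by
  classical
  -- In column `σ k` of `paramX`, only the rows of `reducedParam` up to the `k`-th one contribute.
  have key : ∀ k : Fin m, (∀ i, lowerParam σ p i k ∈ A) ∧ ∀ l, reducedParam σ p k l ∈ A := by
    intro k
    induction k using WellFoundedLT.induction with
    | ind k ih =>
      have hsum : ∀ i l, ∑ k' ∈ Finset.univ.filter (· < k),
          lowerParam σ p i k' * reducedParam σ p k' l ∈ A := fun i l =>
        sum_mem fun k' hk' => mul_mem ((ih k' (by simpa using hk')).1 i)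
          ((ih k' (by simpa using hk')).2 l)
      have hsplit : ∀ i l, (∀ k', k < k' → lowerParam σ p i k' * reducedParam σ p k' l = 0) →
          lowerParam σ p i k * reducedParam σ p k l ∈ A := by
        intro i l h0
        have h1 : paramX σ p i l = (∑ k' ∈ Finset.univ.filter (· < k),
            lowerParam σ p i k' * reducedParam σ p k' l) +
              lowerParam σ p i k * reducedParam σ p k l := by
          rw [paramX, Matrix.mul_apply,
            ← Finset.sum_filter_add_sum_filter_not Finset.univ (· < k)]
          congr 1
          refine Finset.sum_eq_single k (fun k' hk' hne => h0 k' ?_) (by simp)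
          exact lt_of_le_of_ne (by simpa using hk') hne.symm
        have h2 := sub_mem (hX i l) (hsum i l)
        rwa [h1, add_sub_cancel_left] at h2
      have hlow : ∀ i, lowerParam σ p i k ∈ A := by
        intro i
        have h1 := hsplit i (σ k) fun k' hk' => by rw [reducedParam_below hσ p hk', mul_zero]
        rwa [reducedParam_pivot, mul_one] at h1
      refine ⟨hlow, fun l => ?_⟩
      have h1 := hsplit k l fun k' hk' => by
        have h0 : lowerParam σ p k k' = 0 := by
          simp only [lowerParam, Matrix.of_apply]
          rw [if_neg hk'.not_gt, if_neg hk'.ne']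
        rw [h0, zero_mul]
      refine hA _ _ ?_ (hlow k) h1
      simpa [lowerParam] using hp k
  have hup : ∀ j l, upperParam σ p j l ∈ A := by
    intro j l
    rw [upperParam]
    by_cases hj : ∃ i, j = σ i
    · obtain ⟨i, hi⟩ := hj
      rw [(isPP_permMat hσ).rowExtend_apply (permMat_apply_eq_one_iff.2 hi)]
      exact (key i).2 l
    · rw [rowExtend_apply_of_not_exists (by simpa only [permMat_apply_eq_one_iff] using hj)]
      split_ifs
      · exact one_mem A
      · exact zero_mem A
  have hdiag : ∀ i, p (Sum.inr i) ∈ A := fun i => by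
    have h1 := (key i).1 i
    simpa [lowerParam] using h1
  have hfib : ∀ l i, fibreParam σ p l i ∈ A := by
    intro l i
    have h1 : upperParam σ p * paramY σ p * lowerParam σ p =
        (∏ i, p (Sum.inr i)) • fibreParam σ p := by
      rw [paramY, Matrix.mul_assoc, Matrix.mul_assoc (_ * _), Matrix.adjugate_mul,
        ← Matrix.mul_assoc, ← Matrix.mul_assoc, Matrix.mul_adjugate, det_upperParam hσ,
        det_lowerParam, one_smul, Matrix.one_mul, Matrix.mul_smul, Matrix.mul_one]
    have h2 : (∏ i, p (Sum.inr i)) * fibreParam σ p l i ∈ A := by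
      have h3 := congrFun (congrFun h1 l) i
      rw [Matrix.smul_apply, smul_eq_mul] at h3
      rw [← h3, Matrix.mul_apply]
      refine sum_mem fun k _ => mul_mem ?_ ((key i).1 k)
      rw [Matrix.mul_apply]
      exact sum_mem fun j _ => mul_mem (hup l j) (hY j k)
    exact hA _ _ (Finset.prod_ne_zero_iff.2 fun i _ => hp i) (prod_mem fun i _ => hdiag i) h2
  rcases k with ⟨i, l⟩ | i
  · by_cases h1 : ∃ k, k < i ∧ l = σ k
    · obtain ⟨k, hk, rfl⟩ := h1
      have h2 := (key k).1 i
      simpa only [lowerParam, Matrix.of_apply, if_pos hk] using h2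
    · by_cases h2 : σ i < l
      · have h3 := (key i).2 l
        simp only [reducedParam, Matrix.of_apply] at h3
        rwa [if_neg h2.ne', if_pos ⟨h2, fun k hk hlk => h1 ⟨k, hk, hlk⟩⟩] at h3
      · have h3 := hfib l i
        simp only [fibreParam, Matrix.of_apply] at h3
        rwa [if_neg (not_or.2 ⟨h2, fun ⟨k, hk, hlk⟩ => h1 ⟨k, hk, hlk⟩⟩)] at h3
  · exact hdiag i

end Param

/-! ### Irreducible components -/

section Components

theorem irreducibleComponents_eq_range {T ι : Type*} [TopologicalSpace T] [Finite ι]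
    (F : ι → Set T) (hirr : ∀ i, IsIrreducible (F i)) (hcl : ∀ i, IsClosed (F i))
    (hcov : ∀ x, ∃ i, x ∈ F i) (hmax : ∀ i j, F i ⊆ F j → F i = F j) :
    irreducibleComponents T = Set.range F := by
  have hsub : ∀ s : Set T, IsIrreducible s → ∃ i, s ⊆ F i := by
    intro s hs
    have hfin := Set.finite_range F
    obtain ⟨z, hz, hsz⟩ := isIrreducible_iff_sUnion_isClosed.1 hs hfin.toFinset
      (fun z hz => by
        obtain ⟨i, rfl⟩ := hfin.mem_toFinset.1 hz
        exact hcl i)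
      (fun x _ => by
        obtain ⟨i, hi⟩ := hcov x
        exact ⟨F i, hfin.mem_toFinset.2 ⟨i, rfl⟩, hi⟩)
    obtain ⟨i, rfl⟩ := hfin.mem_toFinset.1 hz
    exact ⟨i, hsz⟩
  ext Z
  constructor
  · intro hZ
    obtain ⟨i, hi⟩ := hsub Z hZ.1
    exact ⟨i, le_antisymm (hZ.2 (hirr i) hi) hi⟩
  · rintro ⟨i, rfl⟩
    refine ⟨hirr i, fun s hs his => ?_⟩
    obtain ⟨j, hj⟩ := hsub s hs
    rw [hmax i j (his.trans hj)]
    exact hj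

theorem topologicalKrullDim_zeroLocus {R : Type*} [CommRing R] (I : Ideal R) :
    topologicalKrullDim (PrimeSpectrum.zeroLocus (I : Set R)) = ringKrullDim (R ⧸ I) := by
  have h1 := PrimeSpectrum.isClosedEmbedding_comap_of_surjective (R ⧸ I) (Ideal.Quotient.mk I)
    Ideal.Quotient.mk_surjective
  have h2 : Set.range (PrimeSpectrum.comap (Ideal.Quotient.mk I)) =
      PrimeSpectrum.zeroLocus (I : Set R) := by
    rw [range_comap_of_surjective _ _ Ideal.Quotient.mk_surjective, Ideal.mk_ker]
  rw [← PrimeSpectrum.topologicalKrullDim_eq_ringKrullDim, ← h2]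
  exact (IsHomeomorph.topologicalKrullDim_eq _ h1.isEmbedding.toHomeomorph.isHomeomorph).symm

variable {m n : ℕ}

theorem mk_mem_point_iff {X : Matrix (Fin m) (Fin n) ℂ} {Y : Matrix (Fin n) (Fin m) ℂ}
    (h : IsLowerUpper X Y) (f : MvPolynomial (Coord m n) ℂ) :
    Ideal.Quotient.mk (luIdeal m n) f ∈
      PrimeSpectrum.asIdeal (R := CoordRing m n) (point X Y h) ↔
        MvPolynomial.eval (coords X Y) f = 0 :=
  Iff.rfl

/-- The closure of a stratum, as a set of prime ideals of the coordinate ring. -/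
def closedStratum (π : Matrix (Fin m) (Fin n) ℂ) : Set (PrimeSpectrum (CoordRing m n)) := Ecl π

theorem mem_closedStratum_iff {π : Matrix (Fin m) (Fin n) ℂ} (x : PrimeSpectrum (CoordRing m n)) :
    x ∈ closedStratum π ↔ ∀ f : MvPolynomial (Coord m n) ℂ,
      (∀ X Y, IsLowerUpper X Y → X ∈ borelOrbit π → MvPolynomial.eval (coords X Y) f = 0) →
        Ideal.Quotient.mk (luIdeal m n) f ∈ x.asIdeal := by
  have h1 : closedStratum π =
      PrimeSpectrum.zeroLocus (PrimeSpectrum.vanishingIdeal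
        (E1 π : Set (PrimeSpectrum (CoordRing m n))) : Set (CoordRing m n)) :=
    (PrimeSpectrum.zeroLocus_vanishingIdeal_eq_closure _).symm
  rw [h1, PrimeSpectrum.mem_zeroLocus]
  constructor
  · intro h f hf
    refine h ((PrimeSpectrum.mem_vanishingIdeal _ _).2 ?_)
    rintro _ ⟨X, Y, hXY, hX, rfl⟩
    exact (mk_mem_point_iff hXY f).2 (hf X Y hXY hX)
  · intro h g hg
    obtain ⟨f, rfl⟩ := Ideal.Quotient.mk_surjective g
    refine h f fun X Y hXY hX => (mk_mem_point_iff hXY f).1 ?_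
    exact (PrimeSpectrum.mem_vanishingIdeal _ _).1 hg _ ⟨X, Y, hXY, hX, rfl⟩

variable {σ : Fin m → Fin n}

/-- The ring map of the parametrisation as a map from the coordinate ring of the scheme. -/
noncomputable def coordHom (hσ : Function.Injective σ) :
    CoordRing m n →ₐ[ℂ] MvPolynomial (ParamIndex m n) ℂ :=
  Ideal.Quotient.liftₐ (luIdeal m n) (paramHom σ) fun f hf =>
    (paramHom_eq_zero_iff hσ f).2 fun _ _ h _ => eval_eq_zero_of_mem_luIdeal h f hf

theorem coordHom_mk (hσ : Function.Injective σ) (f : MvPolynomial (Coord m n) ℂ) :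
    coordHom hσ (Ideal.Quotient.mk (luIdeal m n) f) = paramHom σ f :=
  rfl

theorem isPrime_ker_coordHom (hσ : Function.Injective σ) : (RingHom.ker (coordHom hσ)).IsPrime :=
  RingHom.ker_isPrime (coordHom hσ)

theorem closedStratum_permMat (hσ : Function.Injective σ) :
    closedStratum (permMat ℂ σ) =
      PrimeSpectrum.zeroLocus (RingHom.ker (coordHom hσ) : Set (CoordRing m n)) := by
  ext x
  rw [mem_closedStratum_iff, PrimeSpectrum.mem_zeroLocus]
  constructor
  · intro h g hg
    obtain ⟨f, rfl⟩ := Ideal.Quotient.mk_surjective g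
    exact h f ((paramHom_eq_zero_iff hσ f).1 hg)
  · intro h f hf
    exact h (show coordHom hσ _ = 0 from (paramHom_eq_zero_iff hσ f).2 hf)

theorem ringKrullDim_quotient_ker_coordHom (hσ : Function.Injective σ) :
    ringKrullDim (CoordRing m n ⧸ RingHom.ker (coordHom hσ)) = ((m * (n + 1) : ℕ) : WithBot ℕ∞) := by
  have halg : ∀ k, IsAlgebraic (coordHom hσ).range
      (MvPolynomial.X k : MvPolynomial (ParamIndex m n) ℂ) := by
    refine param_mem_of_division_closed hσ MvPolynomial.X (fun i => MvPolynomial.X_ne_zero _)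
      (Subalgebra.algebraicClosure (coordHom hσ).range (MvPolynomial (ParamIndex m n) ℂ))
      (fun y z hy hyA hyz => IsAlgebraic.of_mul (mem_nonZeroDivisors_of_ne_zero hy) hyA hyz)
      (fun i l => ?_) (fun l i => ?_)
    · have h1 : coordHom hσ (Ideal.Quotient.mk _ (MvPolynomial.X (Sum.inl (i, l)))) =
          paramX σ MvPolynomial.X i l := by
        rw [coordHom_mk, paramHom, MvPolynomial.aeval_X, Sum.elim_inl]
      exact isAlgebraic_algebraMap (⟨_, _, h1⟩ : (coordHom hσ).range)
    · have h1 : coordHom hσ (Ideal.Quotient.mk _ (MvPolynomial.X (Sum.inr (l, i)))) =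
          paramY σ MvPolynomial.X l i := by
        rw [coordHom_mk, paramHom, MvPolynomial.aeval_X, Sum.elim_inr]
      exact isAlgebraic_algebraMap (⟨_, _, h1⟩ : (coordHom hσ).range)
  rw [ringKrullDim_quotient_ker _ halg]
  simp only [Fintype.card_sum, Fintype.card_prod, Fintype.card_fin]
  rw [mul_add, mul_one]

theorem E1_subset_Ecl_completion {π : Matrix (Fin m) (Fin n) ℂ} (hπ : IsPP π) (hmn : m ≤ n) :
    E1 π ⊆ Ecl (completion π) := by
  rintro _ ⟨X, Y, hXY, hX, rfl⟩
  exact (mem_closedStratum_iff (point X Y hXY)).2 fun f hf =>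
    (mk_mem_point_iff hXY f).2 (hπ.eval_eq_zero_of_completion hmn f hf hXY hX)

/-- The closed points of the scheme are its complex points. -/
theorem exists_eq_point (x : PrimeSpectrum (CoordRing m n)) (hx : x.asIdeal.IsMaximal) :
    ∃ X Y h, x = (point X Y h : PrimeSpectrum (CoordRing m n)) := by
  have h1 : (x.asIdeal.comap (Ideal.Quotient.mk (luIdeal m n))).IsMaximal :=
    Ideal.comap_isMaximal_of_surjective _ Ideal.Quotient.mk_surjective
  obtain ⟨v, hv⟩ := (MvPolynomial.isMaximal_iff_eq_vanishingIdeal_singleton).1 h1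
  have hmem : ∀ f, Ideal.Quotient.mk (luIdeal m n) f ∈ x.asIdeal ↔ MvPolynomial.eval v f = 0 := by
    intro f
    rw [← Ideal.mem_comap, hv, MvPolynomial.mem_vanishingIdeal_singleton_iff,
      MvPolynomial.aeval_eq_eval]
  let X : Matrix (Fin m) (Fin n) ℂ := Matrix.of fun i j => v (Sum.inl (i, j))
  let Y : Matrix (Fin n) (Fin m) ℂ := Matrix.of fun j i => v (Sum.inr (j, i))
  have hco : coords X Y = v := by
    funext k
    rcases k with k | k <;> rfl
  have hlu : ∀ f ∈ luIdeal m n, MvPolynomial.eval v f = 0 := fun f hf => by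
    rw [← hmem, Ideal.Quotient.eq_zero_iff_mem.2 hf]
    exact zero_mem _
  have hXY : IsLowerUpper X Y := by
    refine ⟨fun i j hij => ?_, fun i j hij => ?_⟩
    · have h2 := hlu _ (Ideal.subset_span (Or.inl ⟨i, j, hij, rfl⟩))
      simpa [Matrix.mul_apply, genericX, genericY, X, Y] using h2
    · have h2 := hlu _ (Ideal.subset_span (Or.inr ⟨i, j, hij, rfl⟩))
      simpa [Matrix.mul_apply, genericX, genericY, X, Y] using h2
  refine ⟨X, Y, hXY, PrimeSpectrum.ext (Ideal.ext fun g => ?_)⟩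
  obtain ⟨f, rfl⟩ := Ideal.Quotient.mk_surjective g
  rw [hmem, mk_mem_point_iff, hco]

/-- The strata of maximal rank are dense: each complex point lies in some stratum, which is in the
closure of a stratum of maximal rank, and the complex points are dense. -/
theorem exists_mem_closedStratum (hmn : m ≤ n) (x : PrimeSpectrum (CoordRing m n)) :
    ∃ σ : {σ : Fin m → Fin n // Function.Injective σ},
      x ∈ closedStratum (permMat ℂ σ.1) := by
  have hcl : IsClosed (⋃ σ : {σ : Fin m → Fin n // Function.Injective σ},
      closedStratum (permMat ℂ σ.1)) :=
    isClosed_iUnion_of_finite fun σ => by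
      rw [closedStratum_permMat σ.2]
      exact PrimeSpectrum.isClosed_zeroLocus _
  have hpts : closedPoints (PrimeSpectrum (CoordRing m n)) ⊆
      ⋃ σ : {σ : Fin m → Fin n // Function.Injective σ},
        closedStratum (permMat ℂ σ.1) := by
    intro y hy
    obtain ⟨X, Y, hXY, rfl⟩ := exists_eq_point y
      ((PrimeSpectrum.isClosed_singleton_iff_isMaximal y).1 hy)
    obtain ⟨b, hb, c, hc, π, hπ, hX⟩ := exists_bruhat X
    have hρ := hπ.isPP_completion
    obtain ⟨σ, hσ, hρσ⟩ := exists_eq_permMat hρ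
      (hρ.rank_eq_iff.2 fun i => hπ.exists_completion_row hmn i)
    refine Set.mem_iUnion.2 ⟨⟨σ, hσ⟩, ?_⟩
    rw [← hρσ]
    exact E1_subset_Ecl_completion hπ hmn
      ⟨X, Y, hXY, mem_borelOrbit_iff.2 ⟨b, hb, c, hc, hX⟩, rfl⟩
  have : JacobsonSpace (PrimeSpectrum (CoordRing m n)) :=
    PrimeSpectrum.isJacobsonRing_iff_jacobsonSpace.1 inferInstance
  have h1 := hcl.closure_subset_iff.2 hpts
  rw [closure_closedPoints] at h1
  exact Set.mem_iUnion.1 (h1 (Set.mem_univ x))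

theorem irreducibleComponents_eq (hmn : m ≤ n) :
    irreducibleComponents (PrimeSpectrum (CoordRing m n)) =
      Set.range fun σ : {σ : Fin m → Fin n // Function.Injective σ} =>
        closedStratum (permMat ℂ σ.1) := by
  refine irreducibleComponents_eq_range _ (fun σ => ?_) (fun σ => ?_)
    (exists_mem_closedStratum hmn) (fun σ τ h => ?_)
  · have h1 := isPrime_ker_coordHom σ.2
    rw [closedStratum_permMat σ.2]
    exact (PrimeSpectrum.isIrreducible_zeroLocus_iff_of_radical _ h1.isRadical).2 h1
  · rw [closedStratum_permMat σ.2]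
    exact PrimeSpectrum.isClosed_zeroLocus _
  · have hσ := isPrime_ker_coordHom σ.2
    have hτ := isPrime_ker_coordHom τ.2
    rw [closedStratum_permMat σ.2, closedStratum_permMat τ.2] at h ⊢
    rw [PrimeSpectrum.zeroLocus_subset_zeroLocus_iff, hσ.radical] at h
    rw [eq_of_le_of_ringKrullDim_quotient_eq h _ (ringKrullDim_quotient_ker_coordHom τ.2)
      (ringKrullDim_quotient_ker_coordHom σ.2)]

end Components

end LowerUpper

theorem mainTheorem8 (m n : ℕ) (hmn : m ≤ n) :
    LowerUpper.IsEquidimensional (LowerUpper.E m n) (m * (n + 1)) ∧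
    irreducibleComponents (LowerUpper.E m n) =
      {Z | ∃ π : Matrix (Fin m) (Fin n) ℂ,
        LowerUpper.IsPartialPerm π ∧ π.rank = m ∧ Z = LowerUpper.Ecl π} ∧
    (∀ π : Matrix (Fin m) (Fin n) ℂ, LowerUpper.IsPartialPerm π → π.rank < m →
      LowerUpper.IsPartialPerm (LowerUpper.completion π) ∧
      (LowerUpper.completion π).rank = m ∧
      LowerUpper.E1 π ⊆ LowerUpper.Ecl (LowerUpper.completion π)) := by
  have hcomp : irreducibleComponents (LowerUpper.E m n) =
      Set.range fun σ : {σ : Fin m → Fin n // Function.Injective σ} =>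
        LowerUpper.Ecl (LowerUpper.permMat ℂ σ.1) := LowerUpper.irreducibleComponents_eq hmn
  refine ⟨⟨⟨LowerUpper.point 0 0 ⟨fun _ _ _ => by simp, fun _ _ _ => by simp⟩⟩, fun Z hZ => ?_⟩,
    ?_, fun π hπ _ => ?_⟩
  · rw [hcomp] at hZ
    obtain ⟨σ, rfl⟩ := hZ
    have h1 := LowerUpper.topologicalKrullDim_zeroLocus (RingHom.ker (LowerUpper.coordHom σ.2))
    rw [← LowerUpper.closedStratum_permMat σ.2, LowerUpper.ringKrullDim_quotient_ker_coordHom σ.2] at h1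
    exact_mod_cast h1
  · rw [hcomp]
    ext Z
    constructor
    · rintro ⟨σ, rfl⟩
      exact ⟨_, LowerUpper.isPP_permMat σ.2, LowerUpper.rank_permMat σ.2, rfl⟩
    · rintro ⟨π, hπ, hr, rfl⟩
      obtain ⟨σ, hσ, rfl⟩ := LowerUpper.exists_eq_permMat hπ.isPP hr
      exact ⟨⟨σ, hσ⟩, rfl⟩
  · have hπ' := hπ.isPP
    exact ⟨hπ'.isPP_completion,
      hπ'.isPP_completion.rank_eq_iff.2 fun i => hπ'.exists_completion_row hmn i,
      LowerUpper.E1_subset_Ecl_completion hπ' hmn⟩
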